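/- All Hilbert spaces are complex and separable. For a Hilbert space $E$ let $L^2(E)$ be the space of square integrable $E$-valued functions on the circle (variable $e^{it}$), and let $H^2(E)\subseteq L^2(E)$ be the Hardy space of those functions whose Fourier coefficients of negative index vanish; $u(0)$ denotes the $0$-th Fourier coefficient of $u\in H^2(E)$. A contractive analytic function $\{E,F,\Theta(z)\}$ is a map $\Theta:\mathbb D\to B(E,F)$ given by a power series converging strongly on $\mathbb D$, with $\|\Theta(z)\|\le 1$ for all $z\in\mathbb D$; it is purely contractive if moreover $\|\Theta(0)e\|<\|e\|$ for all $e\neq 0$. It acts from $L^2(E)$ to $L^2(F)$ by $(\Theta v)(t)=\Theta(e^{it})v(t)$, where $\Theta(e^{it})$ is the strong limit of $\Theta(re^{it})$ as $r\to1^-$, which exists for almost every $t$. Put $\Delta_\Theta=(I-\Theta^*\Theta)^{1/2}$ on $L^2(E)$ and $$\mathcal H(\Theta)=\big[H^2(F)\oplus\overline{\Delta_\Theta L^2(E)}\big]\ominus\{\Theta w\oplus\Delta_\Theta w: w\in H^2(E)\},$$ and let the model operator $T_\Theta$ be the operator on $\mathcal H(\Theta)$ with adjoint $T_\Theta^*(u\oplus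 v)=e^{-it}(u-u(0))\oplus e^{-it}v$. Let $k\ge 2$, let $\{\mathcal E_i,\mathcal E_{i+1},\Theta_i(z)\}$, $i=1,\dots,k$, be contractive analytic functions, and let $\{\mathcal E_1,\mathcal E_{k+1},\Theta(z)\}$ be a purely contractive analytic function with $\Theta(z)=\Theta_k(z)\cdots\Theta_1(z)$ for $z\in\mathbb D$. Write $\Delta_i=\Delta_{\Theta_i}$. Assume that this factorization is $k$-regular, that is, that the isometry $$Z_k:\overline{\Delta_\Theta L^2(\mathcal E_1)}\to\overline{\Delta_kL^2(\mathcal E_k)}\oplus\cdots\oplus\overline{\Delta_1L^2(\mathcal E_1)},\qquad Z_k\Delta_\Theta f=\Delta_k\Theta_{k-1}\cdots\Theta_1f\oplus\cdots\oplus\Delta_2\Theta_1 f\oplus\Delta_1f,$$ is unitary. For $i=1,\dots,k-1$ let $$\mathcal M_i=\Big\{\Theta_k\cdots\Theta_{i+1}u\oplus Z_k^*\big(\Delta_k\Theta_{k-1}\cdots\Theta_{i+1}u\oplus\cdots\oplus\Delta_{i+1}u\oplus v_i\oplus\cdots\oplus v_1\big): u\in H^2(\mathcal E_{i+1}),\ v_j\in\overline{\Delta_jL^2(\mathcal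 E_j)}\Big\}\ominus\{\Theta w\oplus\Delta_\Theta w: w\in H^2(\mathcal E_1)\}.$$ Then $\mathcal M_1\subseteq\cdots\subseteq\mathcal M_{k-1}$ are closed subspaces of $\mathcal H(\Theta)$ invariant under $T_\Theta$. Put $\mathcal H_1=\mathcal M_1$, $\mathcal H_i=\mathcal M_i\ominus\mathcal M_{i-1}$ for $2\le i\le k-1$, and $\mathcal H_k=\mathcal H(\Theta)\ominus\mathcal M_{k-1}$. Then $\mathcal H(\Theta)=\mathcal H_1\oplus\cdots\oplus\mathcal H_k$ (an orthogonal direct sum of closed subspaces), $T_\Theta$ is block upper triangular with respect to this decomposition, i.e. $P_{\mathcal H_i}T_\Theta|_{\mathcal H_j}=0$ for $i>j$, and for each $i=1,\dots,k$ the diagonal block $A_i=P_{\mathcal H_i}T_\Theta|_{\mathcal H_i}$ is unitarily equivalent to $T_{\Theta_i}$. -/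

import Mathlib

open MeasureTheory Topology Filter AddCircle
open scoped ENNReal InnerProductSpace

noncomputable section

namespace RegularFactorization

universe u

/-! ### Defect operators and regular factorizations of Hilbert space contractions -/

section UnitaryEquivalence

variable {X Y : Type*} [NormedAddCommGroup X] [InnerProductSpace ℂ X]
  [NormedAddCommGroup Y] [InnerProductSpace ℂ Y]

/-- Two operators are unitarily equivalent. -/
def UnitarilyEquivalent (A : X →L[ℂ] X) (B : Y →L[ℂ] Y) : Prop :=
  ∃ U : X ≃ₗᵢ[ℂ] Y, ∀ x, U (A x) = B (U x)

end UnitaryEquivalence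

section Operators

variable {X Y : Type*} [NormedAddCommGroup X] [InnerProductSpace ℂ X] [CompleteSpace X]
  [NormedAddCommGroup Y] [InnerProductSpace ℂ Y] [CompleteSpace Y]

/-- The defect operator `D_A = (I - A* A)^{1/2}`. -/
def defectOp (A : X →L[ℂ] Y) : X →L[ℂ] X :=
  CFC.sqrt (1 - A.adjoint ∘L A)

/-- The defect space: the closure of the range of `D_A`. -/
def defectSpace (A : X →L[ℂ] Y) : Submodule ℂ X :=
  (LinearMap.range (defectOp A).toLinearMap).topologicalClosure

theorem isClosed_defectSpace (A : X →L[ℂ] Y) : IsClosed (defectSpace A : Set X) :=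
  Submodule.isClosed_topologicalClosure _

instance (A : X →L[ℂ] Y) : CompleteSpace (defectSpace A) :=
  (isClosed_defectSpace A).completeSpace_coe

/-- The vector `D_A f` of the defect space. -/
def defectVec (A : X →L[ℂ] Y) (f : X) : defectSpace A :=
  ⟨defectOp A f, Submodule.le_topologicalClosure _ ⟨f, rfl⟩⟩

/-- The block `P_K T |_L : L → K` of an operator `T`. -/
def block (T : X →L[ℂ] X) (K L : Submodule ℂ X) [K.HasOrthogonalProjection] : L →L[ℂ] K :=
  K.orthogonalProjectionOnto ∘L T ∘L L.subtypeL

end Operators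

section Chains

variable {k : ℕ} {X : Fin (k + 1) → Type*} [∀ i, NormedAddCommGroup (X i)]
  [∀ i, InnerProductSpace ℂ (X i)]

/-- For a chain of operators `A_j : X_j → X_{j+1}` (`0 ≤ j < k`), the product
`A_{j-1} ⋯ A_i : X_i → X_j` for `i ≤ j` (the identity for `i = j`).
By convention it is `0` for `j < i`. -/
def chainProd (A : ∀ j : Fin k, X j.castSucc →L[ℂ] X j.succ) (i j : Fin (k + 1)) :
    X i →L[ℂ] X j :=
  Fin.induction (motive := fun j => X i →L[ℂ] X j)
    (if h : i = 0 then h ▸ ContinuousLinearMap.id ℂ (X i) else 0)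
    (fun j ih => if h : i = j.succ then h ▸ ContinuousLinearMap.id ℂ (X i) else (A j) ∘L ih) j

theorem chainProd_self (A : ∀ j : Fin k, X j.castSucc →L[ℂ] X j.succ) (i : Fin (k + 1)) :
    chainProd A i i = ContinuousLinearMap.id ℂ (X i) := by
  induction i using Fin.cases with
  | zero => simp [chainProd]
  | succ i => simp [chainProd]

theorem chainProd_succ (A : ∀ j : Fin k, X j.castSucc →L[ℂ] X j.succ) (i : Fin (k + 1))
    (j : Fin k) (h : i ≤ j.castSucc) :
    chainProd A i j.succ = (A j) ∘L chainProd A i j.castSucc := by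
  have h' : i ≠ j.succ := by
    rintro rfl
    simp [Fin.le_def] at h
  simp [chainProd, h']

variable [∀ i, CompleteSpace (X i)]

/-- `Z` is the unitary extension of the isometry `Z_k`, that is, it maps `D_A f` to the vector
with components `D_{A_j} A_{j-1} ⋯ A_0 f`.  As the vectors `D_A f` are dense in the defect
space of `A`, there is at most one such `Z`. -/
def IsDefectUnitary (A : X 0 →L[ℂ] X (Fin.last k))
    (As : ∀ j : Fin k, X j.castSucc →L[ℂ] X j.succ)
    (Z : defectSpace A ≃ₗᵢ[ℂ] PiLp 2 (fun j : Fin k => defectSpace (As j))) : Prop :=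
  ∀ (f : X 0) (j : Fin k),
    Z (defectVec A f) j = defectVec (As j) (chainProd As 0 j.castSucc f)

/-- The factorization `A = A_{k-1} ⋯ A_0` is `k`-regular: the isometry
`D_A f ↦ (D_{A_j} A_{j-1} ⋯ A_0 f)_j` extends to a unitary operator from the defect space of `A`
onto the direct sum of the defect spaces of the factors. -/
def IsRegular (A : X 0 →L[ℂ] X (Fin.last k))
    (As : ∀ j : Fin k, X j.castSucc →L[ℂ] X j.succ) : Prop :=
  ∃ Z : defectSpace A ≃ₗᵢ[ℂ] PiLp 2 (fun j : Fin k => defectSpace (As j)),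
    IsDefectUnitary A As Z

/-- The unitary operator `Z_k` of a `k`-regular factorization. -/
def IsRegular.unitary {A : X 0 →L[ℂ] X (Fin.last k)}
    {As : ∀ j : Fin k, X j.castSucc →L[ℂ] X j.succ} (h : IsRegular A As) :
    defectSpace A ≃ₗᵢ[ℂ] PiLp 2 (fun j : Fin k => defectSpace (As j)) :=
  h.choose

end Chains

/-! ### Vector valued `L²` and `H²` on the circle -/

instance factTwoPiPos : Fact (0 < 2 * Real.pi) := ⟨Real.two_pi_pos⟩

/-- `L²(E)`: square integrable `E`-valued functions of `t ∈ ℝ / 2πℤ`, with respect to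
`dt / 2π`. -/
abbrev L2 (E : Type u) [NormedAddCommGroup E] : Type u :=
  Lp E 2 (haarAddCircle : Measure (AddCircle (2 * Real.pi)))

section Hardy

variable {E F : Type*} [NormedAddCommGroup E] [InnerProductSpace ℂ E] [CompleteSpace E]
  [NormedAddCommGroup F] [InnerProductSpace ℂ F] [CompleteSpace F]

/-- The `n`-th Fourier coefficient, as a bounded operator `L²(E) → E`. -/
def fourierCoeffL (E : Type*) [NormedAddCommGroup E] [InnerProductSpace ℂ E] [CompleteSpace E]
    (n : ℤ) : L2 E →L[ℂ] E :=
  (ContinuousLinearMap.lsmul ℂ ℂ).lpPairing haarAddCircle 2 2 (fourierLp 2 (-n))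

theorem fourierCoeffL_apply (n : ℤ) (f : L2 E) : fourierCoeffL E n f = fourierCoeff f n := by
  rw [fourierCoeffL, ContinuousLinearMap.lpPairing_eq_integral, fourierCoeff]
  refine integral_congr_ae ?_
  filter_upwards [coeFn_fourierLp (T := 2 * Real.pi) 2 (-n)] with t ht
  rw [ht, ContinuousLinearMap.lsmul_apply]

/-- Multiplication by `e^{int}` on `L²(E)`. -/
def expMul (E : Type*) [NormedAddCommGroup E] [InnerProductSpace ℂ E] [CompleteSpace E]
    (n : ℤ) : L2 E →L[ℂ] L2 E :=
  (ContinuousLinearMap.lsmul ℂ ℂ).holderL haarAddCircle ∞ 2 2 (fourierLp ∞ n)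

theorem coeFn_expMul (n : ℤ) (f : L2 E) :
    expMul E n f =ᵐ[haarAddCircle] fun t => (fourier n t : ℂ) • f t := by
  have h := (ContinuousLinearMap.lsmul ℂ ℂ (E := E)).coeFn_holder (r := 2)
    (fourierLp (T := 2 * Real.pi) ∞ n) f
  filter_upwards [h, coeFn_fourierLp (T := 2 * Real.pi) ∞ n] with t h1 h2
  rw [h2, ContinuousLinearMap.lsmul_apply] at h1
  exact h1

/-- The constant functions, as a bounded operator `E → L²(E)`. -/
def constL (E : Type*) [NormedAddCommGroup E] [InnerProductSpace ℂ E] [CompleteSpace E] :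
    E →L[ℂ] L2 E :=
  Lp.constL 2 haarAddCircle ℂ

/-- The Hardy space `H²(E)`, as the subspace of those functions in `L²(E)` whose Fourier
coefficients of negative index vanish.  The value `u(0)` of the corresponding analytic function
on the disc is the Fourier coefficient of index `0`. -/
def H2 (E : Type*) [NormedAddCommGroup E] [InnerProductSpace ℂ E] [CompleteSpace E] :
    Submodule ℂ (L2 E) :=
  ⨅ n : {n : ℤ // n < 0}, LinearMap.ker (fourierCoeffL E n).toLinearMap

theorem mem_H2_iff (f : L2 E) : f ∈ H2 E ↔ ∀ n : ℤ, n < 0 → fourierCoeff f n = 0 := by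
  simp [H2, Submodule.mem_iInf, fourierCoeffL_apply]

theorem isClosed_H2 : IsClosed (H2 E : Set (L2 E)) := by
  rw [H2, Submodule.coe_iInf]
  exact isClosed_iInter fun n => (fourierCoeffL E n).isClosed_ker

/-- `u ↦ e^{-it} (u - u(0))`. -/
def backwardShift (E : Type*) [NormedAddCommGroup E] [InnerProductSpace ℂ E] [CompleteSpace E] :
    L2 E →L[ℂ] L2 E :=
  expMul E (-1) ∘L (ContinuousLinearMap.id ℂ (L2 E) - constL E ∘L fourierCoeffL E 0)

/-! ### Contractive analytic functions -/

/-- `Θ` is (on the open unit disc) a contractive analytic function `{E, F, Θ(z)}`: it is given by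
a strongly convergent power series and bounded by `1`. Values outside the disc are irrelevant. -/
def IsContractiveAnalytic (Θ : ℂ → E →L[ℂ] F) : Prop :=
  (∃ a : ℕ → E →L[ℂ] F, ∀ z ∈ Metric.ball (0 : ℂ) 1, ∀ e : E,
    HasSum (fun n => z ^ n • a n e) (Θ z e)) ∧
  ∀ z ∈ Metric.ball (0 : ℂ) 1, ‖Θ z‖ ≤ 1

/-- `Θ` is purely contractive analytic. -/
def IsPurelyContractive (Θ : ℂ → E →L[ℂ] F) : Prop :=
  IsContractiveAnalytic Θ ∧ ∀ e : E, e ≠ 0 → ‖Θ 0 e‖ < ‖e‖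

open Classical in
/-- The boundary value `Θ(e^{it})`: the strong limit of `Θ(r e^{it})` as `r → 1-`.  For a
contractive analytic function between separable Hilbert spaces it exists for almost every `t`;
where it does not exist, the value `0` is used. -/
def boundaryValue (Θ : ℂ → E →L[ℂ] F) (t : AddCircle (2 * Real.pi)) : E →L[ℂ] F :=
  if h : ∃ A : E →L[ℂ] F, ∀ e : E,
      Tendsto (fun r : ℝ => Θ ((r : ℂ) * (toCircle t : ℂ)) e) (𝓝[<] 1) (𝓝 (A e))
  then h.choose else 0

open Classical in
/-- The multiplication operator `L²(E) → L²(F)`, `(Θ v)(t) = Θ(e^{it}) v(t)`.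
For a contractive analytic function between separable Hilbert spaces the operator with this
property exists (and it is unique for every `Θ`). -/
def mulOp (Θ : ℂ → E →L[ℂ] F) : L2 E →L[ℂ] L2 F :=
  if h : ∃ M : L2 E →L[ℂ] L2 F, ∀ v : L2 E,
      M v =ᵐ[haarAddCircle] fun t => boundaryValue Θ t (v t)
  then h.choose else 0

/-! ### The functional model -/

/-- `H²(F) ⊕ closure (Δ_Θ L²(E))`, inside `L²(F) ⊕ L²(E)`; here `Δ_Θ` is the defect operator of
the multiplication operator `Θ : L²(E) → L²(F)`. -/
def modelAmbient (Θ : ℂ → E →L[ℂ] F) : Submodule ℂ (WithLp 2 (L2 F × L2 E)) :=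
  (H2 F).comap (WithLp.fstL 2 ℂ (L2 F) (L2 E)).toLinearMap ⊓
    (defectSpace (mulOp Θ)).comap (WithLp.sndL 2 ℂ (L2 F) (L2 E)).toLinearMap

/-- `{Θ w ⊕ Δ_Θ w : w ∈ H²(E)}`. -/
def modelGraph (Θ : ℂ → E →L[ℂ] F) : Submodule ℂ (WithLp 2 (L2 F × L2 E)) :=
  (H2 E).map ((WithLp.linearEquiv 2 ℂ (L2 F × L2 E)).symm.toLinearMap ∘ₗ
    (mulOp Θ).toLinearMap.prod (defectOp (mulOp Θ)).toLinearMap)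

theorem mem_modelGraph_iff (Θ : ℂ → E →L[ℂ] F) (x : WithLp 2 (L2 F × L2 E)) :
    x ∈ modelGraph Θ ↔
      ∃ w ∈ H2 E, WithLp.toLp 2 (mulOp Θ w, defectOp (mulOp Θ) w) = x := by
  rfl

/-- The model space
`H(Θ) = [H²(F) ⊕ closure (Δ_Θ L²(E))] ⊖ {Θ w ⊕ Δ_Θ w : w ∈ H²(E)}`. -/
def modelSpace (Θ : ℂ → E →L[ℂ] F) : Submodule ℂ (WithLp 2 (L2 F × L2 E)) :=
  modelAmbient Θ ⊓ (modelGraph Θ)ᗮ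

theorem isClosed_modelSpace (Θ : ℂ → E →L[ℂ] F) :
    IsClosed (modelSpace Θ : Set (WithLp 2 (L2 F × L2 E))) := by
  refine IsClosed.inter (IsClosed.inter ?_ ?_) (Submodule.isClosed_orthogonal _)
  · exact isClosed_H2.preimage (WithLp.fstL 2 ℂ (L2 F) (L2 E)).continuous
  · exact (isClosed_defectSpace _).preimage (WithLp.sndL 2 ℂ (L2 F) (L2 E)).continuous

instance (Θ : ℂ → E →L[ℂ] F) : CompleteSpace (modelSpace Θ) :=
  (isClosed_modelSpace Θ).completeSpace_coe

/-- `u ⊕ v ↦ e^{-it} (u - u(0)) ⊕ e^{-it} v` on `L²(F) ⊕ L²(E)`. -/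
def modelShift (E F : Type*) [NormedAddCommGroup E] [InnerProductSpace ℂ E] [CompleteSpace E]
    [NormedAddCommGroup F] [InnerProductSpace ℂ F] [CompleteSpace F] :
    WithLp 2 (L2 F × L2 E) →L[ℂ] WithLp 2 (L2 F × L2 E) :=
  (WithLp.prodContinuousLinearEquiv 2 ℂ (L2 F) (L2 E)).symm.toContinuousLinearMap ∘L
    (backwardShift F).prodMap (expMul E (-1)) ∘L
    (WithLp.prodContinuousLinearEquiv 2 ℂ (L2 F) (L2 E)).toContinuousLinearMap

theorem modelShift_apply (u : L2 F) (v : L2 E) :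
    modelShift E F (WithLp.toLp 2 (u, v)) =
      WithLp.toLp 2 (expMul F (-1) (u - constL F (fourierCoeff u 0)), expMul E (-1) v) := by
  simp [modelShift, backwardShift, fourierCoeffL_apply]

/-- The adjoint `T_Θ^*` of the model operator,
`T_Θ^* (u ⊕ v) = e^{-it} (u - u(0)) ⊕ e^{-it} v` on `H(Θ)`.  For a contractive analytic function
this expression stays in `H(Θ)`, so that the projection only restricts the codomain. -/
def modelAdjoint (Θ : ℂ → E →L[ℂ] F) : modelSpace Θ →L[ℂ] modelSpace Θ :=
  (modelSpace Θ).orthogonalProjectionOnto ∘L modelShift E F ∘L (modelSpace Θ).subtypeL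

/-- The model operator `T_Θ` on `H(Θ)`. -/
def modelOp (Θ : ℂ → E →L[ℂ] F) : modelSpace Θ →L[ℂ] modelSpace Θ :=
  (modelAdjoint Θ).adjoint

end Hardy

/-! ### The chain of invariant subspaces of a regular factorization -/

section InvariantChain

variable {k : ℕ} {E : Fin (k + 1) → Type u} [∀ i, NormedAddCommGroup (E i)]
  [∀ i, InnerProductSpace ℂ (E i)] [∀ i, CompleteSpace (E i)]
  {Θ : ℂ → E 0 →L[ℂ] E (Fin.last k)} {Θs : ∀ j : Fin k, ℂ → E j.castSucc →L[ℂ] E j.succ}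

/-- The factorization `Θ = Θ_{k-1} ⋯ Θ_0` of contractive analytic functions is `k`-regular:
the factorization of multiplication operators on the `L²` spaces is. -/
def IsRegularAnalytic (Θ : ℂ → E 0 →L[ℂ] E (Fin.last k))
    (Θs : ∀ j : Fin k, ℂ → E j.castSucc →L[ℂ] E j.succ) : Prop :=
  IsRegular (X := fun i => L2 (E i)) (mulOp Θ) (fun j => mulOp (Θs j))

/-- The product `Θ_{j-1} ⋯ Θ_i : L²(E_i) → L²(E_j)` of multiplication operators, `i ≤ j`. -/
def mulProd (Θs : ∀ j : Fin k, ℂ → E j.castSucc →L[ℂ] E j.succ) (i j : Fin (k + 1)) :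
    L2 (E i) →L[ℂ] L2 (E j) :=
  chainProd (X := fun i => L2 (E i)) (fun j => mulOp (Θs j)) i j

/-- The unitary `Z_k : closure (Δ_Θ L²(E_0)) → ⨁_j closure (Δ_j L²(E_j))` of a `k`-regular
factorization. -/
def IsRegularAnalytic.Z (h : IsRegularAnalytic Θ Θs) :
    defectSpace (mulOp Θ) ≃ₗᵢ[ℂ] PiLp 2 (fun j : Fin k => defectSpace (mulOp (Θs j))) :=
  IsRegular.unitary (X := fun i => L2 (E i)) h

/-- The subspace of all vectors
`Θ_{k-1} ⋯ Θ_i u ⊕ Z_k^* (Δ_{k-1} Θ_{k-2} ⋯ Θ_i u ⊕ ⋯ ⊕ Δ_i u ⊕ v_{i-1} ⊕ ⋯ ⊕ v_0)`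
with `u ∈ H²(E_i)` and `v_j ∈ closure (Δ_j L²(E_j))` arbitrary.  The vector in brackets is `w`;
its components of index `j < i` are the free vectors `v_j`. -/
def chainSpan (h : IsRegularAnalytic Θ Θs) (i : Fin (k + 1)) :
    Submodule ℂ (WithLp 2 (L2 (E (Fin.last k)) × L2 (E 0))) where
  carrier := {x | ∃ u ∈ H2 (E i), ∃ w : PiLp 2 (fun j : Fin k => defectSpace (mulOp (Θs j))),
    (∀ j : Fin k, i ≤ j.castSucc →
      w j = defectVec (mulOp (Θs j)) (mulProd Θs i j.castSucc u)) ∧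
    x = WithLp.toLp 2 (mulProd Θs i (Fin.last k) u, (h.Z.symm w : L2 (E 0)))}
  zero_mem' := by
    refine ⟨0, zero_mem _, 0, fun j _ => ?_, ?_⟩
    · ext1; simp [defectVec]
    · simp only [map_zero, ZeroMemClass.coe_zero]
      rfl
  add_mem' := by
    rintro x y ⟨u, hu, w, hw, rfl⟩ ⟨u', hu', w', hw', rfl⟩
    refine ⟨u + u', add_mem hu hu', w + w', fun j hj => ?_, ?_⟩
    · ext1; simp [defectVec, hw j hj, hw' j hj]
    · simp [← WithLp.toLp_add]
  smul_mem' := by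
    rintro c x ⟨u, hu, w, hw, rfl⟩
    refine ⟨c • u, Submodule.smul_mem _ c hu, c • w, fun j hj => ?_, ?_⟩
    · ext1; simp [defectVec, hw j hj]
    · simp [← WithLp.toLp_smul]

/-- The subspace `M_i` of `H(Θ)` (`0 < i < k`) of a `k`-regular factorization: the vectors of
`chainSpan` orthogonal to `{Θ w ⊕ Δ_Θ w : w ∈ H²(E_0)}`, that is, those in `H(Θ)`. -/
def invSubspace (h : IsRegularAnalytic Θ Θs) (i : Fin (k + 1)) : Submodule ℂ (modelSpace Θ) :=
  (chainSpan h i).comap (modelSpace Θ).subtype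

/-- The chain `M_1 ⊆ ⋯ ⊆ M_{k-1}`, completed by `{0}` at `0` and by `H(Θ)` at `k`. -/
def flag (h : IsRegularAnalytic Θ Θs) (i : Fin (k + 1)) : Submodule ℂ (modelSpace Θ) :=
  if i = 0 then ⊥ else if i = Fin.last k then ⊤ else invSubspace h i

/-- The successive orthogonal differences: `M_1`, then `M_{i+1} ⊖ M_i` for `0 < i < k - 1`, and
finally `H(Θ) ⊖ M_{k-1}`. -/
def diffSpace (h : IsRegularAnalytic Θ Θs) (i : Fin k) : Submodule ℂ (modelSpace Θ) :=
  flag h i.succ ⊓ (flag h i.castSucc)ᗮ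

end InvariantChain

end RegularFactorization

end

open RegularFactorization

noncomputable section

namespace RegularFactorization

universe u

/-! ### Defect operators of contractions -/

section Defect

variable {X Y : Type*} [NormedAddCommGroup X] [InnerProductSpace ℂ X] [CompleteSpace X]
  [NormedAddCommGroup Y] [InnerProductSpace ℂ Y] [CompleteSpace Y]

/-! Let `K` be the ambient space `modelAmbient Θ` and `G` its graph subspace, so that `H(Θ) = K ⊖
G`. Drop the orthogonality to `G` from the definition of `M_i` and call the result `N_i`
(`chainSpan`). Factors are numbered from `0`. Then `G = N_0 ⊆ N_1 ⊆ ⋯ ⊆ N_k = K`: raising the index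
replaces `u` by `Θ_i u` and frees the `i`-th defect component. Hence `M_i = N_i ⊖ G`, and the
successive differences in `H(Θ)` are the spaces `N_{i+1} ⊖ N_i`.

The operator `T_Θ` is the compression to `H(Θ)` of multiplication by `e^{it}`, so the two differ on
`H(Θ)` only by vectors of `G` (`forwardShift_sub_modelOp_mem`). Each `N_i` is invariant under this
multiplication, because the `Θ_j`, their defect operators and `Z_k` all commute with it. As `G ⊆
N_i`, each `M_i` is invariant under `T_Θ`, which gives the triangular form.

For the diagonal blocks, the ambient space of the model of `Θ_i` is embedded by `J_i`
(`blockIsometry`): `u` goes through the later factors, `v` becomes the `i`-th defect component, and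
the earlier components are zero. Telescoping `‖Θ_j x‖² + ‖Δ_j x‖² = ‖x‖²` shows that `J_i` is
isometric. Let `R_i` consist of the vectors `0 ⊕ Z_k^* w` with `w` supported on the indices below
`i`. Then `N_{i+1} = ran J_i ⊕ R_i`, and `N_i = J_i(graph of Θ_i) ⊕ R_i`; therefore `J_i` maps
`H(Θ_i)` onto `N_{i+1} ⊖ N_i`. Since `J_i` commutes with multiplication by `e^{it}` and sends the
graph of `Θ_i` into `N_i`, it carries `T_{Θ_i}` to the diagonal block.

The rest is analysis: the boundary values must exist almost everywhere and define multiplication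
operators that are contractive, preserve `H²` and respect products. This rests on Fatou's theorem
for Hilbert space valued Hardy functions, proved through the Poisson kernel at Lebesgue points,
together with separability. -/

theorem adjoint_defectOp (A : X →L[ℂ] Y) : (defectOp A).adjoint = defectOp A :=
  (CFC.sqrt_nonneg (1 - A.adjoint ∘L A)).isSelfAdjoint

theorem one_sub_adjoint_comp_nonneg {A : X →L[ℂ] Y} (hA : ∀ x, ‖A x‖ ≤ ‖x‖) :
    0 ≤ 1 - A.adjoint ∘L A := by
  rw [ContinuousLinearMap.nonneg_iff_isPositive, ContinuousLinearMap.isPositive_iff_complex]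
  intro x
  have h : ⟪(1 - A.adjoint ∘L A) x, x⟫_ℂ = ((‖x‖ ^ 2 - ‖A x‖ ^ 2 : ℝ) : ℂ) := by
    rw [_root_.sub_apply, inner_sub_left, one_apply_eq_self,
      ContinuousLinearMap.comp_apply, ContinuousLinearMap.adjoint_inner_left,
      inner_self_eq_norm_sq_to_K, inner_self_eq_norm_sq_to_K]
    push_cast
    rfl
  rw [h]
  refine ⟨by rw [RCLike.re_to_complex, Complex.ofReal_re], ?_⟩
  rw [RCLike.re_to_complex, Complex.ofReal_re]
  have := hA x
  have := norm_nonneg (A x)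
  nlinarith

/-- Pair `D_A² = I - A*A` with `x`; contractivity makes `I - A*A` positive, so that the square root
is the genuine one. All later isometry statements come from this identity. -/
theorem norm_sq_defectOp {A : X →L[ℂ] Y} (hA : ∀ x, ‖A x‖ ≤ ‖x‖) (x : X) :
    ‖A x‖ ^ 2 + ‖defectOp A x‖ ^ 2 = ‖x‖ ^ 2 := by
  have h : defectOp A * defectOp A = 1 - A.adjoint ∘L A :=
    CFC.sqrt_mul_sqrt_self _ (one_sub_adjoint_comp_nonneg hA)
  have h1 : ⟪defectOp A x, defectOp A x⟫_ℂ = ⟪x, x⟫_ℂ - ⟪A x, A x⟫_ℂ := by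
    rw [← ContinuousLinearMap.adjoint_inner_left, adjoint_defectOp,
      ← ContinuousLinearMap.comp_apply, ← ContinuousLinearMap.mul_def, h]
    simp [inner_sub_left, ContinuousLinearMap.adjoint_inner_left]
  simp only [inner_self_eq_norm_sq_to_K] at h1
  have h2 : ‖defectOp A x‖ ^ 2 = ‖x‖ ^ 2 - ‖A x‖ ^ 2 := by exact_mod_cast h1
  linarith

/-- The defect operator commutes with a unitary operator which `A` intertwines. -/
theorem defectOp_intertwine {A : X →L[ℂ] Y} {U : X →L[ℂ] X} {V : Y →L[ℂ] Y}
    (hV : V.adjoint ∘L V = 1) (hU' : U ∘L U.adjoint = 1)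
    (hA : A ∘L U = V ∘L A) (x : X) : defectOp A (U x) = U (defectOp A x) := by
  have h1 : U.adjoint ∘L A.adjoint ∘L A ∘L U = A.adjoint ∘L A := by
    rw [hA, ← ContinuousLinearMap.comp_assoc, ← ContinuousLinearMap.adjoint_comp, hA,
      ContinuousLinearMap.adjoint_comp, ContinuousLinearMap.comp_assoc,
      ← ContinuousLinearMap.comp_assoc _ V, hV]
    rfl
  have h2 : Commute (1 - A.adjoint ∘L A) U := by
    refine (Commute.one_left U).sub_left ?_
    change (A.adjoint ∘L A) ∘L U = U ∘L (A.adjoint ∘L A)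
    -- Multiplying `U*A*AU = A*A` by `U` on the left, with `UU* = 1`, gives the commutation.
    conv_rhs => rw [← h1, ← ContinuousLinearMap.comp_assoc, hU']
    rfl
  -- Commutation with `I - A*A` passes to its square root through the functional calculus.
  have h3 : Commute (defectOp A) U := by
    unfold defectOp CFC.sqrt
    exact h2.cfcₙ_nnreal _
  exact DFunLike.congr_fun h3.eq x

end Defect

section ClosedImage

/-- A map bounded below on a complete space has a complete image. This gives closedness of the graph
and of the spaces `chainSpan`. -/
theorem isClosed_map_of_bound {X Y : Type*} [NormedAddCommGroup X] [NormedSpace ℂ X]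
    [CompleteSpace X] [NormedAddCommGroup Y] [NormedSpace ℂ Y] (L : X →L[ℂ] Y)
    {S : Submodule ℂ X} (hS : IsClosed (S : Set X)) (C : NNReal)
    (hL : ∀ x ∈ S, ‖x‖ ≤ C * ‖L x‖) : IsClosed (S.map L.toLinearMap : Set Y) := by
  have : CompleteSpace S := hS.completeSpace_coe
  have h : AntilipschitzWith C (L ∘L S.subtypeL) :=
    AddMonoidHomClass.antilipschitz_of_bound _ fun x => hL x x.2
  have h2 := h.isClosed_range (L ∘L S.subtypeL).uniformContinuous
  convert h2 using 1
  ext y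
  simp

end ClosedImage

section Chain

variable {k : ℕ} {X : Fin (k + 1) → Type*} [∀ i, NormedAddCommGroup (X i)]
  [∀ i, InnerProductSpace ℂ (X i)]

/-- The recursion for `chainProd` adds factors at the target end; here one is split off at the
source end, as needed to compare consecutive spaces of the chain. -/
theorem chainProd_castSucc_eq (A : ∀ j : Fin k, X j.castSucc →L[ℂ] X j.succ) (i : Fin k)
    (j : Fin (k + 1)) (h : i.succ ≤ j) (x : X i.castSucc) :
    chainProd A i.castSucc j x = chainProd A i.succ j (A i x) := by
  induction j using Fin.induction with
  | zero => simp at h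
  | succ j ih =>
    rcases h.eq_or_lt with h | h
    · obtain rfl : i = j := Fin.succ_injective _ h
      rw [chainProd_succ _ _ _ le_rfl, chainProd_self, chainProd_self]
      rfl
    · have h' : i.succ ≤ j.castSucc := by
        rw [Fin.lt_def] at h; rw [Fin.le_def]; simp at h ⊢; omega
      have h'' : i.castSucc ≤ j.castSucc := (Fin.castSucc_lt_succ (i := i)).le.trans h'
      rw [chainProd_succ _ _ _ h', chainProd_succ _ _ _ h'']
      simp [ih h']

variable [∀ i, CompleteSpace (X i)]

/-- The norm identity `‖A_{m-1} ⋯ A_i x‖² + ∑_{i ≤ j < m} ‖Δ_j A_{j-1} ⋯ A_i x‖² = ‖x‖²`. -/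
theorem norm_sq_chainProd {A : ∀ j : Fin k, X j.castSucc →L[ℂ] X j.succ}
    (hA : ∀ j x, ‖A j x‖ ≤ ‖x‖) (i : Fin (k + 1)) (x : X i) :
    ‖chainProd A i (Fin.last k) x‖ ^ 2 +
      ∑ j : Fin k, (if i ≤ j.castSucc then
        ‖defectOp (A j) (chainProd A i j.castSucc x)‖ ^ 2 else 0) = ‖x‖ ^ 2 := by
  -- Stopping the product at `m` makes the identity telescope: one more factor splits the first term
  -- by `norm_sq_defectOp`.
  have key : ∀ m : Fin (k + 1), i ≤ m → ‖chainProd A i m x‖ ^ 2 +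
      ∑ j : Fin k, (if i ≤ j.castSucc ∧ j.castSucc < m then
        ‖defectOp (A j) (chainProd A i j.castSucc x)‖ ^ 2 else 0) = ‖x‖ ^ 2 := by
    intro m hm
    induction m using Fin.induction with
    | zero =>
      obtain rfl : i = 0 := by simpa using hm
      simp [chainProd_self]
    | succ m ih =>
      rcases hm.eq_or_lt with rfl | h
      · rw [chainProd_self, Finset.sum_eq_zero]
        · simp
        · intro j _
          rw [if_neg]
          rintro ⟨h1, h2⟩
          exact absurd h1 (not_le.2 h2)
      · have h' : i ≤ m.castSucc := by
          rw [Fin.lt_def] at h; rw [Fin.le_def]; simp at h ⊢; omega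
        rw [← ih h', ← norm_sq_defectOp (hA m) (chainProd A i m.castSucc x),
          chainProd_succ _ _ _ h', add_assoc]
        congr 1
        rw [← Finset.add_sum_erase _ _ (Finset.mem_univ m),
          ← Finset.add_sum_erase Finset.univ (fun j : Fin k =>
            if i ≤ j.castSucc ∧ j.castSucc < m.castSucc then _ else _) (Finset.mem_univ m)]
        rw [if_pos ⟨h', Fin.castSucc_lt_succ⟩, if_neg (fun h => lt_irrefl _ h.2), zero_add]
        congr 1
        refine Finset.sum_congr rfl fun j hj => ?_
        have hj' : j ≠ m := Finset.ne_of_mem_erase hj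
        have : (j.castSucc < m.succ) ↔ (j.castSucc < m.castSucc) := by
          rw [Fin.lt_def, Fin.lt_def]
          have := Fin.val_ne_of_ne hj'
          simp; omega
        simp only [this]
  have := key (Fin.last k) (Fin.le_last i)
  simpa [Fin.castSucc_lt_last] using this

end Chain

/-! ### The Poisson kernel of the disc -/

section Poisson

/-- The circle `ℝ / 2πℤ`. -/
abbrev Circ : Type := AddCircle (2 * Real.pi)

/-- The quotient norm is `|x - 2πn|` for some integer `n`, and the cosine ignores sign and period.
With the kernel written through `‖s‖`, its radial monotonicity becomes visible. -/
theorem toCircle_re_eq_cos_norm (s : Circ) : (toCircle s : ℂ).re = Real.cos ‖s‖ := by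
  induction s using QuotientAddGroup.induction_on with
  | H x =>
    change (toCircle (x : AddCircle (2 * Real.pi)) : ℂ).re = Real.cos ‖(x : AddCircle (2 * Real.pi))‖
    rw [AddCircle.norm_eq, Real.cos_abs, Real.cos_sub_int_mul_two_pi, toCircle_apply_mk,
      div_self Real.two_pi_pos.ne', one_mul, Circle.coe_exp, Complex.exp_ofReal_mul_I_re]

theorem norm_circ_le_pi (s : Circ) : ‖s‖ ≤ Real.pi := by
  have h := AddCircle.norm_le_half_period (2 * Real.pi) (x := s) Real.two_pi_pos.ne'
  rw [abs_of_pos Real.two_pi_pos] at h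
  linarith

/-- The Poisson kernel of the unit disc. -/
def poisson (r : ℝ) (s : Circ) : ℝ :=
  (1 - r ^ 2) / (1 + r ^ 2 - 2 * r * Real.cos ‖s‖)

variable {r : ℝ}

theorem poisson_denom_pos (hr : 0 ≤ r) (hr1 : r < 1) (x : ℝ) :
    0 < 1 + r ^ 2 - 2 * r * Real.cos x := by
  nlinarith [Real.cos_le_one x, Real.neg_one_le_cos x]

theorem poisson_nonneg (hr : 0 ≤ r) (hr1 : r < 1) (s : Circ) : 0 ≤ poisson r s :=
  div_nonneg (by nlinarith) (poisson_denom_pos hr hr1 _).le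

theorem continuous_poisson (hr : 0 ≤ r) (hr1 : r < 1) : Continuous (poisson r) := by
  unfold poisson
  exact continuous_const.div (by fun_prop) fun s => (poisson_denom_pos hr hr1 _).ne'

theorem poisson_le_poisson (hr : 0 ≤ r) (hr1 : r < 1) {s s' : Circ} (h : ‖s‖ ≤ ‖s'‖) :
    poisson r s' ≤ poisson r s := by
  unfold poisson
  have := Real.cos_le_cos_of_nonneg_of_le_pi (norm_nonneg s) (norm_circ_le_pi s') h
  have h1 := poisson_denom_pos hr hr1 ‖s‖
  refine div_le_div_of_nonneg_left (by nlinarith) h1 ?_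
  nlinarith

/-- For `cos ‖s‖ ≤ cos δ` the denominator is at least `1 + r² - 2r cos δ = (r - cos δ)² + sin² δ`,
whence the constant. -/
theorem poisson_le_of_le_norm (hr : 0 ≤ r) (hr1 : r < 1) {δ : ℝ} (hδ : 0 < δ) {s : Circ}
    (hδ' : δ < Real.pi) (h : δ ≤ ‖s‖) : poisson r s ≤ (1 - r ^ 2) / Real.sin δ ^ 2 := by
  unfold poisson
  have := Real.cos_le_cos_of_nonneg_of_le_pi hδ.le (norm_circ_le_pi s) h
  have h1 : 0 < Real.sin δ := Real.sin_pos_of_pos_of_lt_pi hδ hδ'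
  refine div_le_div_of_nonneg_left (by nlinarith) (by positivity) ?_
  nlinarith [Real.sin_sq_add_cos_sq δ, sq_nonneg (r - Real.cos δ)]

/-- The superlevel sets of the Poisson kernel are balls. -/
theorem poisson_superlevel (hr : 0 ≤ r) (hr1 : r < 1) (l : ℝ) (t : Circ) :
    {s | l ≤ poisson r (t - s)} = ∅ ∨
      ∃ s₀, l ≤ poisson r s₀ ∧ {s | l ≤ poisson r (t - s)} = Metric.closedBall t ‖s₀‖ := by
  rcases Set.eq_empty_or_nonempty {s | l ≤ poisson r s} with h | h
  · left
    ext s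
    simpa using fun h' : l ≤ poisson r (t - s) => (h ▸ (show t - s ∈ {s | l ≤ poisson r s} from h') :)
  · right
    have hc : IsCompact {s | l ≤ poisson r s} :=
      (isClosed_le continuous_const (continuous_poisson hr hr1)).isCompact
    -- As the kernel decreases with `‖s‖`, the farthest point of the superlevel set fixes the
    -- radius.
    obtain ⟨s₀, h0, h1⟩ := hc.exists_isMaxOn h continuous_norm.continuousOn
    refine ⟨s₀, h0, ?_⟩
    ext s
    rw [Metric.mem_closedBall, dist_comm, dist_eq_norm]
    exact ⟨fun hs => h1 hs, fun hs => le_trans h0 (poisson_le_poisson hr hr1 hs)⟩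

/-- With `w = r e^{is}` the kernel is `1/(1-w) + w̄/(1-w̄)`, a sum of two geometric series; the
shift to `n + 1` in the second counts the constant term only once. -/
theorem poisson_hasSum (hr : 0 ≤ r) (hr1 : r < 1) (s : Circ) :
    HasSum (fun n : ℕ => ((r : ℂ) ^ n * fourier n s + (r : ℂ) ^ (n + 1) * fourier (-(n + 1 : ℤ)) s))
      (poisson r s : ℂ) := by
  set w : ℂ := r * toCircle s with hw
  have hn : ‖w‖ < 1 := by
    rw [hw, norm_mul, Circle.norm_coe, Complex.norm_real, Real.norm_eq_abs, abs_of_nonneg hr]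
    simpa using hr1
  have hn' : ‖(starRingEnd ℂ) w‖ < 1 := by rwa [RCLike.norm_conj]
  have h1 : HasSum (fun n : ℕ => w ^ n) (1 - w)⁻¹ := hasSum_geometric_of_norm_lt_one hn
  have h2 : HasSum (fun n : ℕ => (starRingEnd ℂ) w * (starRingEnd ℂ) w ^ n)
      ((starRingEnd ℂ) w * (1 - (starRingEnd ℂ) w)⁻¹) :=
    (hasSum_geometric_of_norm_lt_one hn').mul_left _
  have hf : (fun n : ℕ => ((r : ℂ) ^ n * fourier n s + (r : ℂ) ^ (n + 1) *
      fourier (-(n + 1 : ℤ)) s)) =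
      fun n : ℕ => w ^ n + (starRingEnd ℂ) w * (starRingEnd ℂ) w ^ n := by
    funext n
    rw [← pow_succ', fourier_neg, fourier_apply, fourier_apply, hw, mul_pow, map_mul, mul_pow,
      show ((n : ℤ) + 1) • s = (n + 1 : ℕ) • s by rw [← natCast_zsmul]; push_cast; rfl,
      toCircle_nsmul, natCast_zsmul, toCircle_nsmul]
    simp
  have hs : (poisson r s : ℂ) = (1 - w)⁻¹ + (starRingEnd ℂ) w * (1 - (starRingEnd ℂ) w)⁻¹ := by
    have hw1 : (1 : ℂ) - w ≠ 0 := by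
      intro h; rw [sub_eq_zero] at h; rw [← h] at hn; simp at hn
    have hw2 : (1 : ℂ) - (starRingEnd ℂ) w ≠ 0 := by
      intro h; rw [sub_eq_zero] at h; rw [← h] at hn'; simp at hn'
    have e1 : w * (starRingEnd ℂ) w = ((r ^ 2 : ℝ) : ℂ) := by
      rw [Complex.mul_conj, Complex.normSq_eq_norm_sq, hw, norm_mul, Circle.norm_coe]
      simp
    have e2 : w + (starRingEnd ℂ) w = ((2 * r * Real.cos ‖s‖ : ℝ) : ℂ) := by
      rw [Complex.add_conj, ← toCircle_re_eq_cos_norm, hw, Complex.re_ofReal_mul]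
      push_cast; ring
    have e3 : ((1 + r ^ 2 - 2 * r * Real.cos ‖s‖ : ℝ) : ℂ) = (1 - w) * (1 - (starRingEnd ℂ) w) := by
      rw [Complex.ofReal_sub, ← e2, Complex.ofReal_add, ← e1]; push_cast; ring
    unfold poisson
    rw [Complex.ofReal_div, e3, Complex.ofReal_sub, ← e1]
    field_simp
    push_cast; ring
  rw [hf, hs]
  exact h1.add h2

end Poisson

/-! ### Poisson integrals of vector valued functions -/

section PoissonIntegral

variable {F : Type*} [NormedAddCommGroup F] [NormedSpace ℂ F] {r : ℝ}

theorem fourier_sub (n : ℤ) (t s : Circ) :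
    (fourier n (t - s) : ℂ) = fourier n t * fourier (-n) s := by
  rw [fourier_apply, fourier_apply, fourier_apply, smul_sub, neg_smul, sub_eq_add_neg,
    toCircle_add, Circle.coe_mul]

theorem norm_fourier_apply (n : ℤ) (t : Circ) : ‖(fourier n t : ℂ)‖ = 1 := by
  rw [fourier_apply, Circle.norm_coe]

theorem integral_fourier_sub_smul (b : Circ → F) (n : ℤ) (t : Circ) :
    ∫ s, (fourier n (t - s) : ℂ) • b s ∂haarAddCircle = (fourier n t : ℂ) • fourierCoeff b n := by
  simp_rw [fourier_sub, mul_smul]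
  rw [integral_smul, fourierCoeff]

theorem integrable_fourier_sub_smul {b : Circ → F} (hb : Integrable b haarAddCircle) (n : ℤ)
    (t : Circ) : Integrable (fun s => (fourier n (t - s) : ℂ) • b s) haarAddCircle := by
  simp_rw [fourier_sub, mul_smul]
  exact (hb.fourier_smul (-n)).smul (fourier n t : ℂ)

/-- Negative frequencies of the kernel meet vanishing coefficients, so the Poisson integral
collapses to a power series. Termwise integration is dominated by `2 rⁿ ‖b s‖`. -/
theorem hasSum_poisson_integral [CompleteSpace F] (hr : 0 ≤ r) (hr1 : r < 1) {b : Circ → F}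
    (hb : Integrable b haarAddCircle) (hb' : ∀ n < 0, fourierCoeff b n = 0) (t : Circ) :
    HasSum (fun n : ℕ => ((r : ℂ) ^ n * fourier n t) • fourierCoeff b n)
      (∫ s, (poisson r (t - s) : ℂ) • b s ∂haarAddCircle) := by
  have hs : Summable fun n : ℕ => 2 * r ^ n :=
    (summable_geometric_of_lt_one hr hr1).mul_left 2
  have key := hasSum_integral_of_dominated_convergence (μ := haarAddCircle)
    (F := fun (n : ℕ) (s : Circ) => ((r : ℂ) ^ n * fourier n (t - s) +
      (r : ℂ) ^ (n + 1) * fourier (-(n + 1 : ℤ)) (t - s)) • b s)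
    (f := fun s => (poisson r (t - s) : ℂ) • b s)
    (fun n s => (2 * r ^ n) * ‖b s‖) ?_ ?_ ?_ ?_ ?_
  · convert key using 2 with n
    simp_rw [add_smul, mul_smul]
    have i1 : Integrable (fun s => (r : ℂ) ^ n • (fourier n (t - s) : ℂ) • b s) haarAddCircle :=
      (integrable_fourier_sub_smul hb _ t).smul _
    have i2 : Integrable (fun s => (r : ℂ) ^ (n + 1) • (fourier (-(n + 1 : ℤ)) (t - s) : ℂ) • b s)
        haarAddCircle := (integrable_fourier_sub_smul hb _ t).smul _
    rw [integral_add i1 i2, integral_smul, integral_smul,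
      integral_fourier_sub_smul, integral_fourier_sub_smul, hb' (-(n + 1 : ℤ)) (by omega)]
    simp
  · intro n
    refine AEStronglyMeasurable.smul ?_ hb.aestronglyMeasurable
    exact (by fun_prop : Continuous fun s : Circ => ((r : ℂ) ^ n * fourier n (t - s) +
      (r : ℂ) ^ (n + 1) * fourier (-(n + 1 : ℤ)) (t - s))).aestronglyMeasurable
  · refine fun n => Eventually.of_forall fun s => ?_
    rw [norm_smul]
    refine mul_le_mul_of_nonneg_right ?_ (norm_nonneg _)
    refine (norm_add_le _ _).trans ?_
    rw [norm_mul, norm_mul, norm_fourier_apply, norm_fourier_apply, norm_pow, norm_pow,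
      Complex.norm_real, Real.norm_eq_abs, abs_of_nonneg hr, pow_succ]
    nlinarith [pow_nonneg hr n]
  · exact Eventually.of_forall fun s => hs.mul_right _
  · simp_rw [tsum_mul_right]
    exact hb.norm.const_mul _
  · exact Eventually.of_forall fun s => (poisson_hasSum hr hr1 (t - s)).smul_const (b s)

theorem integral_poisson (hr : 0 ≤ r) (hr1 : r < 1) (t : Circ) :
    ∫ s, poisson r (t - s) ∂haarAddCircle = 1 := by
  have h0 : ∀ n : ℤ, n ≠ 0 → fourierCoeff (fun _ : Circ => (1 : ℂ)) n = 0 := by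
    intro n hn
    have := fourierCoeff_fourier (T := 2 * Real.pi) 0
    have h2 := congrFun this n
    rw [Pi.single_eq_of_ne hn] at h2
    rw [← h2]
    congr 1
    ext x
    simp
  have h1 : fourierCoeff (fun _ : Circ => (1 : ℂ)) 0 = 1 := by
    simp [fourierCoeff]
  have key := hasSum_poisson_integral hr hr1 (b := fun _ => (1 : ℂ)) (integrable_const _)
    (fun n hn => h0 n hn.ne) t
  have h2 := hasSum_single (f := fun n : ℕ => ((r : ℂ) ^ n * fourier n t) •
    fourierCoeff (fun _ : Circ => (1 : ℂ)) n) 0 (fun n hn => by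
      rw [h0 n (by exact_mod_cast hn), smul_zero])
  have h3 := key.unique h2
  simp only [smul_eq_mul, mul_one, Nat.cast_zero, h1, pow_zero, fourier_zero] at h3
  rw [integral_complex_ofReal] at h3
  exact_mod_cast h3

end PoissonIntegral

/-! ### Lebesgue points on the circle -/

section Lebesgue

variable {F : Type*} [NormedAddCommGroup F]

/-- Lebesgue measure is a constant multiple of normalised Haar measure, and doubling ignores
constants. -/
instance : IsUnifLocDoublingMeasure (haarAddCircle : Measure Circ) := by
  obtain ⟨C, hC⟩ := IsUnifLocDoublingMeasure.exists_measure_closedBall_le_mul''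
    (μ := (volume : Measure Circ))
  refine ⟨⟨C, ?_⟩⟩
  filter_upwards [hC] with ε hε x
  have h := hε x
  rw [volume_eq_smul_haarAddCircle, Measure.smul_apply, Measure.smul_apply, smul_eq_mul,
    smul_eq_mul, mul_left_comm] at h
  refine (ENNReal.mul_le_mul_iff_right ?_ ENNReal.ofReal_ne_top).1 h
  simpa using Real.pi_pos

/-- Lebesgue differentiation with the mean multiplied out, in the form that `lintegral_poisson_le`
takes as hypothesis. -/
theorem ae_lebesgue_point {b : Circ → F} (hb : Integrable b haarAddCircle) :
    ∀ᵐ t ∂(haarAddCircle : Measure Circ), ∀ ε : ℝ, 0 < ε → ∃ δ : ℝ, 0 < δ ∧ ∀ ρ, 0 < ρ → ρ < δ →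
      ∫⁻ s in Metric.closedBall t ρ, ‖b s - b t‖ₑ ∂haarAddCircle ≤
        ENNReal.ofReal ε * haarAddCircle (Metric.closedBall t ρ) := by
  filter_upwards [IsUnifLocDoublingMeasure.ae_tendsto_average_norm_sub haarAddCircle
    hb.locallyIntegrable 1] with t ht ε hε
  have h := ht (fun _ : ℝ => t) id (l := 𝓝[>] 0) tendsto_id (by
    filter_upwards [self_mem_nhdsWithin] with ρ hρ
    exact Metric.mem_closedBall_self (by simpa using (Set.mem_Ioi.1 hρ).le))
  obtain ⟨δ, hδ, h⟩ := mem_nhdsGT_iff_exists_Ioo_subset.1 (h.eventually_lt_const hε)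
  refine ⟨δ, hδ, fun ρ h0 h1 => ?_⟩
  have h2 := h ⟨h0, h1⟩
  have hpos : 0 < haarAddCircle.real (Metric.closedBall t ρ) :=
    ENNReal.toReal_pos (Metric.measure_closedBall_pos _ _ h0).ne' (measure_ne_top _ _)
  simp only [Set.mem_ofPred_eq, id, setAverage_eq, smul_eq_mul] at h2
  rw [inv_mul_lt_iff₀ hpos] at h2
  have hi : IntegrableOn (fun s => b s - b t) (Metric.closedBall t ρ) haarAddCircle :=
    (hb.sub (integrable_const _)).integrableOn
  rw [← ofReal_integral_norm_eq_lintegral_enorm hi,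
    ← ofReal_measureReal, ← ENNReal.ofReal_mul hε.le]
  exact ENNReal.ofReal_le_ofReal (h2.le.trans_eq (mul_comm _ _))

end Lebesgue

/-! ### Fatou's theorem -/

section Fatou

/-- Needed because a superlevel ball may have radius zero, which the Lebesgue point estimate does
not cover. -/
theorem haarAddCircle_singleton (t : Circ) : (haarAddCircle : Measure Circ) {t} = 0 := by
  have h := AddCircle.volume_closedBall (2 * Real.pi) (x := t) 0
  rw [Metric.closedBall_zero, volume_eq_smul_haarAddCircle, Measure.smul_apply, smul_eq_mul,
    mul_zero, min_eq_right Real.two_pi_pos.le, ENNReal.ofReal_zero, mul_eq_zero] at h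
  refine h.resolve_left ?_
  simpa using Real.pi_pos

variable {F : Type*} [NormedAddCommGroup F] [NormedSpace ℂ F] {r : ℝ}

theorem lintegral_poisson (hr : 0 ≤ r) (hr1 : r < 1) (t : Circ) :
    ∫⁻ s, ENNReal.ofReal (poisson r (t - s)) ∂haarAddCircle = 1 := by
  have hc : Continuous fun s => poisson r (t - s) :=
    (continuous_poisson hr hr1).comp (continuous_const.sub continuous_id)
  have hi : Integrable (fun s => poisson r (t - s)) (haarAddCircle : Measure Circ) :=
    hc.integrable_of_hasCompactSupport (HasCompactSupport.of_compactSpace _)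
  rw [← ofReal_integral_eq_lintegral_ofReal hi
    (Eventually.of_forall fun s => poisson_nonneg hr hr1 _), integral_poisson hr hr1,
    ENNReal.ofReal_one]

/-- The Poisson integral of a finite measure whose density at small scales is at most `ε`. -/
theorem lintegral_poisson_le (hr : 0 ≤ r) (hr1 : r < 1) {t : Circ} {ν : Measure Circ}
    [IsFiniteMeasure ν] (hν : ν {t} = 0) {ε : ℝ≥0∞} {δ : ℝ} (hδ : 0 < δ) (hδ' : δ < Real.pi)
    (h : ∀ ρ, 0 < ρ → ρ < δ →
      ν (Metric.closedBall t ρ) ≤ ε * haarAddCircle (Metric.closedBall t ρ)) :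
    ∫⁻ s, ENNReal.ofReal (poisson r (t - s)) ∂ν ≤
      ε + ENNReal.ofReal ((1 - r ^ 2) / Real.sin δ ^ 2) * ν Set.univ := by
  have hc : Continuous fun s => poisson r (t - s) :=
    (continuous_poisson hr hr1).comp (continuous_const.sub continuous_id)
  have hm := hc.measurable
  set Λ := (1 - r ^ 2) / Real.sin δ ^ 2 with hΛ
  -- Layer cake: a level above `Λ` gives a ball of radius less than `δ`, where the density bound
  -- applies. The levels in `(0, Λ]` contribute at most `Λ` times the total mass.
  have h1 : ∀ l : ℝ, ν {s | l ≤ poisson r (t - s)} ≤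
      ε * haarAddCircle {s | l ≤ poisson r (t - s)} +
        (Set.Iic Λ).indicator (fun _ => ν Set.univ) l := by
    intro l
    by_cases hl : l ≤ Λ
    · rw [Set.indicator_of_mem (Set.mem_Iic.2 hl)]
      exact (measure_mono (Set.subset_univ _)).trans le_add_self
    · rw [Set.indicator_of_notMem (by simpa using hl), add_zero]
      rcases poisson_superlevel hr hr1 l t with h0 | ⟨s₀, h0, h2⟩
      · simp [h0]
      · rw [h2]
        rcases (norm_nonneg s₀).eq_or_lt with h3 | h3
        · rw [← h3, Metric.closedBall_zero, hν]
          exact zero_le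
        · refine h _ h3 (lt_of_not_ge fun h4 => hl ?_)
          exact h0.trans (poisson_le_of_le_norm hr hr1 hδ hδ' h4)
  rw [lintegral_eq_lintegral_meas_le ν (Eventually.of_forall fun s => poisson_nonneg hr hr1 _)
    hm.aemeasurable]
  have hanti : Measurable fun l : ℝ =>
      (haarAddCircle : Measure Circ) {s | l ≤ poisson r (t - s)} :=
    Antitone.measurable fun l l' hll => measure_mono fun s hs => le_trans hll hs
  calc ∫⁻ l in Set.Ioi 0, ν {s | l ≤ poisson r (t - s)}
      ≤ ∫⁻ l in Set.Ioi 0, (ε * haarAddCircle {s | l ≤ poisson r (t - s)} +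
        (Set.Iic Λ).indicator (fun _ => ν Set.univ) l) := lintegral_mono h1
    _ = ε * (∫⁻ l in Set.Ioi 0, haarAddCircle {s | l ≤ poisson r (t - s)}) +
        ν Set.univ * volume (Set.Iic Λ ∩ Set.Ioi 0) := by
      rw [lintegral_add_left (hanti.const_mul _), lintegral_const_mul _ hanti,
        lintegral_indicator_const measurableSet_Iic, Measure.restrict_apply measurableSet_Iic]
    _ = _ := by
      rw [← lintegral_eq_lintegral_meas_le haarAddCircle
        (Eventually.of_forall fun s => poisson_nonneg hr hr1 _) hm.aemeasurable,
        lintegral_poisson hr hr1, mul_one, Set.inter_comm, Set.Ioi_inter_Iic, Real.volume_Ioc,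
        sub_zero, mul_comm (ν _)]

/-- **Fatou's theorem** for Poisson integrals of vector valued functions. -/
theorem ae_tendsto_poisson_integral [CompleteSpace F] {b : Circ → F}
    (hb : Integrable b haarAddCircle) :
    ∀ᵐ t ∂(haarAddCircle : Measure Circ),
      Tendsto (fun r : ℝ => ∫ s, (poisson r (t - s) : ℂ) • b s ∂haarAddCircle) (𝓝[<] 1)
        (𝓝 (b t)) := by
  filter_upwards [ae_lebesgue_point hb] with t ht
  -- The deviation of `b` from `b t`, as a measure; at a Lebesgue point its density at small scales
  -- is small.
  set ν : Measure Circ := (haarAddCircle : Measure Circ).withDensity fun s => ‖b s - b t‖ₑ with hν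
  have hbt : Integrable (fun s => b s - b t) (haarAddCircle : Measure Circ) :=
    hb.sub (integrable_const _)
  have : IsFiniteMeasure ν := isFiniteMeasure_withDensity hbt.hasFiniteIntegral.ne
  have hν0 : ν {t} = 0 := withDensity_absolutelyContinuous _ _ (haarAddCircle_singleton t)
  rw [tendsto_iff_edist_tendsto_0, ENNReal.tendsto_nhds_zero]
  intro ε hε
  obtain ⟨e, he, he'⟩ : ∃ e : ℝ, 0 < e ∧ ENNReal.ofReal e + ENNReal.ofReal e ≤ ε := by
    obtain ⟨e, he0, he1⟩ := ENNReal.lt_iff_exists_nnreal_btwn.1 hε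
    refine ⟨e / 2, by simpa using he0, ?_⟩
    rw [← ENNReal.ofReal_add (by positivity) (by positivity), add_halves,
      ENNReal.ofReal_coe_nnreal]
    exact he1.le
  obtain ⟨δ₀, hδ₀, hball⟩ := ht e he
  -- The cap `1` keeps `δ` below `π`, so that `sin δ > 0`.
  set δ := min δ₀ 1
  have hδ : 0 < δ := lt_min hδ₀ one_pos
  have hδ' : δ < Real.pi := (min_le_right _ _).trans_lt (by linarith [Real.pi_gt_three])
  have hlim : Tendsto (fun r : ℝ => ENNReal.ofReal ((1 - r ^ 2) / Real.sin δ ^ 2) * ν Set.univ)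
      (𝓝[<] 1) (𝓝 0) := by
    have h1 : Tendsto (fun r : ℝ => (1 - r ^ 2) / Real.sin δ ^ 2) (𝓝[<] 1) (𝓝 0) := by
      have : Continuous fun r : ℝ => (1 - r ^ 2) / Real.sin δ ^ 2 := by fun_prop
      simpa using (this.tendsto 1).mono_left nhdsWithin_le_nhds
    have h2 := ENNReal.Tendsto.mul_const (b := ν Set.univ) (ENNReal.tendsto_ofReal h1)
      (Or.inr (measure_ne_top _ _))
    simpa using h2
  filter_upwards [ENNReal.tendsto_nhds_zero.1 hlim (ENNReal.ofReal e) (by simpa using he),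
    Ioo_mem_nhdsLT (show (0 : ℝ) < 1 by norm_num)] with r hr1 hr2
  have hr := hr2.1.le
  have hc : Continuous fun s => poisson r (t - s) :=
    (continuous_poisson hr hr2.2).comp (continuous_const.sub continuous_id)
  have hcC : Continuous fun s => (poisson r (t - s) : ℂ) := Complex.continuous_ofReal.comp hc
  have hint : ∀ {g : Circ → F}, Integrable g haarAddCircle →
      Integrable (fun s => (poisson r (t - s) : ℂ) • g s) haarAddCircle := by
    intro g hg
    obtain ⟨C, hC⟩ := isCompact_univ.exists_bound_of_continuousOn hcC.continuousOn
    exact hg.bdd_smul C hcC.aestronglyMeasurable (Eventually.of_forall fun s => hC s trivial)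
  have hone : b t = ∫ s, (poisson r (t - s) : ℂ) • b t ∂haarAddCircle := by
    rw [integral_smul_const, integral_complex_ofReal, integral_poisson hr hr2.2]
    simp
  have hdiff : (∫ s, (poisson r (t - s) : ℂ) • b s ∂haarAddCircle) - b t =
      ∫ s, (poisson r (t - s) : ℂ) • (b s - b t) ∂haarAddCircle := by
    simp_rw [smul_sub]
    rw [integral_sub (hint hb) (hint (integrable_const _)), ← hone]
  have hL := lintegral_poisson_le hr hr2.2 hν0 (ε := ENNReal.ofReal e) hδ hδ' fun ρ h0 h1 => by
    rw [hν, withDensity_apply _ measurableSet_closedBall]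
    exact hball ρ h0 (h1.trans_le (min_le_left _ _))
  rw [edist_eq_enorm_sub, hdiff]
  refine (enorm_integral_le_lintegral_enorm _).trans (le_trans ?_ he')
  refine le_trans (le_of_eq ?_) (hL.trans (add_le_add le_rfl hr1))
  rw [hν, lintegral_withDensity_eq_lintegral_mul₀ hbt.aestronglyMeasurable.enorm
    (hc.measurable.ennreal_ofReal).aemeasurable]
  refine lintegral_congr fun s => ?_
  rw [enorm_smul, Pi.mul_apply, mul_comm]
  congr 1
  rw [← ofReal_norm, Complex.norm_real, Real.norm_eq_abs,
    abs_of_nonneg (poisson_nonneg hr hr2.2 _)]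

end Fatou

/-! ### Exponentials and Fourier coefficients in L² -/

section ExpMul

variable {E : Type*} [NormedAddCommGroup E] [InnerProductSpace ℂ E] [CompleteSpace E]

theorem expMul_expMul (m n : ℤ) (f : L2 E) : expMul E m (expMul E n f) = expMul E (m + n) f := by
  ext1
  filter_upwards [coeFn_expMul m (expMul E n f), coeFn_expMul n f, coeFn_expMul (m + n) f]
    with t h1 h2 h3
  rw [h1, h2, h3, fourier_add, mul_smul]

theorem expMul_zero (f : L2 E) : expMul E 0 f = f := by
  ext1
  filter_upwards [coeFn_expMul 0 f] with t h1
  rw [h1, fourier_zero, one_smul]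

theorem inner_expMul_expMul (n : ℤ) (f g : L2 E) :
    ⟪expMul E n f, expMul E n g⟫_ℂ = ⟪f, g⟫_ℂ := by
  rw [L2.inner_def, L2.inner_def]
  refine integral_congr_ae ?_
  filter_upwards [coeFn_expMul n f, coeFn_expMul n g] with t h1 h2
  rw [h1, h2, inner_smul_left, inner_smul_right, ← mul_assoc, ← fourier_neg, ← fourier_add,
    neg_add_cancel, fourier_zero, one_mul]

theorem inner_expMul_left (n : ℤ) (f g : L2 E) :
    ⟪expMul E n f, g⟫_ℂ = ⟪f, expMul E (-n) g⟫_ℂ := by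
  rw [← inner_expMul_expMul n f, expMul_expMul, add_neg_cancel, expMul_zero]

theorem adjoint_expMul (n : ℤ) : (expMul E n).adjoint = expMul E (-n) := by
  symm
  rw [ContinuousLinearMap.eq_adjoint_iff]
  intro x y
  rw [inner_expMul_left, neg_neg]

theorem norm_expMul (n : ℤ) (f : L2 E) : ‖expMul E n f‖ = ‖f‖ := by
  have h := inner_expMul_expMul n f f
  rw [inner_self_eq_norm_sq_to_K, inner_self_eq_norm_sq_to_K] at h
  have h' : ‖expMul E n f‖ ^ 2 = ‖f‖ ^ 2 := by exact_mod_cast h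
  exact (sq_eq_sq₀ (norm_nonneg _) (norm_nonneg _)).1 h'

omit [InnerProductSpace ℂ E] [CompleteSpace E] in
theorem integrable_L2 (f : L2 E) : Integrable f (haarAddCircle : Measure Circ) :=
  (Lp.memLp f).integrable (by norm_num)

theorem fourierCoeff_expMul (m n : ℤ) (f : L2 E) :
    fourierCoeff (expMul E n f) m = fourierCoeff f (m - n) := by
  refine integral_congr_ae ?_
  filter_upwards [coeFn_expMul n f] with t h
  rw [h, ← mul_smul, ← fourier_add]
  congr 3
  ring

theorem coeFn_constL (e : E) : constL E e =ᵐ[haarAddCircle] fun _ => e :=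
  Lp.coeFn_const 2 haarAddCircle e

theorem fourierCoeff_constL (e : E) (n : ℤ) :
    fourierCoeff (constL E e) n = if n = 0 then e else 0 := by
  have h := fourierCoeff_fourier (T := 2 * Real.pi) 0
  have h2 := congrFun h n
  have h3 : fourierCoeff (constL E e) n =
      fourierCoeff (fourier 0 : C(Circ, ℂ)) n • e := by
    rw [fourierCoeff, fourierCoeff, ← integral_smul_const]
    refine integral_congr_ae ?_
    filter_upwards [coeFn_constL e] with t h
    rw [h, fourier_zero, smul_eq_mul, mul_one]
  rw [h3, h2, Pi.single_apply]
  split_ifs <;> simp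

theorem norm_constL (e : E) : ‖constL E e‖ = ‖e‖ := by
  have h := Lp.norm_const (p := 2) (μ := (haarAddCircle : Measure Circ)) (c := e)
    (NeZero.ne _)
  rw [probReal_univ, Real.one_rpow, mul_one] at h
  exact h

/-- The isometry `e ↦ e^{int} e` of `E` into `L²(E)`. -/
def monomial (E : Type*) [NormedAddCommGroup E] [InnerProductSpace ℂ E] [CompleteSpace E]
    (n : ℤ) : E →ₗᵢ[ℂ] L2 E where
  toLinearMap := (expMul E n ∘L constL E).toLinearMap
  norm_map' e := by
    change ‖expMul E n (constL E e)‖ = _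
    rw [norm_expMul, norm_constL]

theorem monomial_apply (n : ℤ) (e : E) : monomial E n e = expMul E n (constL E e) := rfl

theorem coeFn_monomial (n : ℤ) (e : E) :
    monomial E n e =ᵐ[haarAddCircle] fun t => (fourier n t : ℂ) • e := by
  filter_upwards [coeFn_expMul n (constL E e), coeFn_constL e] with t h1 h2
  rw [monomial_apply, h1, h2]

theorem fourierCoeff_monomial (m n : ℤ) (e : E) :
    fourierCoeff (monomial E n e) m = if m = n then e else 0 := by
  rw [monomial_apply, fourierCoeff_expMul, fourierCoeff_constL]
  simp [sub_eq_zero]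

theorem inner_constL (e : E) (f : L2 E) : ⟪constL E e, f⟫_ℂ = ⟪e, fourierCoeff f 0⟫_ℂ := by
  rw [L2.inner_def, fourierCoeff]
  simp only [neg_zero, fourier_zero, one_smul]
  rw [← integral_inner (integrable_L2 f)]
  refine integral_congr_ae ?_
  filter_upwards [coeFn_constL e] with t h
  rw [h]

theorem orthogonalFamily_monomial :
    OrthogonalFamily ℂ (fun _ : ℤ => E) (fun n => monomial E n) := by
  intro m n hmn e f
  rw [monomial_apply, inner_expMul_left, inner_constL, fourierCoeff_expMul, fourierCoeff_monomial,
    if_neg, inner_zero_right]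
  simpa using hmn

end ExpMul

/-! ### Power series with square summable coefficients -/

section HardySeries

variable {F : Type*} [NormedAddCommGroup F] [InnerProductSpace ℂ F] [CompleteSpace F]

/-- The square summability of the coefficients of a bounded analytic function. -/
theorem sum_norm_sq_le_of_bounded {c : ℕ → F} {C : ℝ}
    (hc : ∀ r : ℝ, 0 ≤ r → r < 1 → Summable fun n => r ^ n * ‖c n‖)
    (hC : ∀ r : ℝ, 0 ≤ r → r < 1 → ∀ t : Circ,
      ‖∑' n : ℕ, ((r : ℂ) ^ n * fourier n t) • c n‖ ≤ C) (S : Finset ℕ) :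
    ∑ n ∈ S, ‖c n‖ ^ 2 ≤ C ^ 2 := by
  have hC0 : 0 ≤ C := (norm_nonneg _).trans (hC 0 le_rfl one_pos 0)
  -- On the circle of radius `r` the series converges uniformly, and orthogonality of the monomials
  -- bounds the partial square sums by the `L²` norm, hence by `C` as the measure has mass one. Then
  -- `r → 1`.
  have key : ∀ r : ℝ, 0 ≤ r → r < 1 → ∑ n ∈ S, (r ^ n * ‖c n‖) ^ 2 ≤ C ^ 2 := by
    intro r hr hr1
    let G : ℕ → C(Circ, F) := fun n => ⟨fun t => ((r : ℂ) ^ n * fourier n t) • c n, by fun_prop⟩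
    have hG : Summable G := by
      refine Summable.of_norm_bounded (hc r hr hr1) fun n => ?_
      rw [ContinuousMap.norm_le _ (by positivity)]
      intro t
      change ‖((r : ℂ) ^ n * fourier n t) • c n‖ ≤ _
      rw [norm_smul, norm_mul, norm_fourier_apply, norm_pow, Complex.norm_real, Real.norm_eq_abs,
        abs_of_nonneg hr, mul_one]
    have hGt : ∀ t, (∑' n, G n) t = ∑' n : ℕ, ((r : ℂ) ^ n * fourier n t) • c n := fun t =>
      ((ContinuousMap.evalCLM ℂ t).hasSum hG.hasSum).tsum_eq.symm
    have hL : HasSum (fun n : ℕ => monomial F n (((r : ℂ) ^ n) • c n))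
        (ContinuousMap.toLp 2 haarAddCircle ℂ (∑' n, G n)) := by
      convert (ContinuousMap.toLp 2 haarAddCircle ℂ).hasSum hG.hasSum using 2 with n
      ext1
      filter_upwards [coeFn_monomial n (((r : ℂ) ^ n) • c n),
        ContinuousMap.coeFn_toLp (p := 2) (𝕜 := ℂ) haarAddCircle (G n)] with t h1 h2
      rw [h1, h2, ← mul_smul, mul_comm]
      rfl
    have hn : ‖ContinuousMap.toLp 2 haarAddCircle ℂ (∑' n, G n)‖ ≤ C := by
      have := Lp.norm_le_of_ae_bound (f := ContinuousMap.toLp 2 haarAddCircle ℂ (∑' n, G n)) hC0 (by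
        filter_upwards [ContinuousMap.coeFn_toLp (p := 2) (𝕜 := ℂ) haarAddCircle (∑' n, G n)]
          with t h
        rw [h, hGt]
        exact hC r hr hr1 t)
      simpa [measureUnivNNReal] using this
    have ho := (orthogonalFamily_monomial (E := F)).comp Nat.cast_injective
    have hs : ∀ S : Finset ℕ, ‖∑ n ∈ S, monomial F n (((r : ℂ) ^ n) • c n)‖ ^ 2 =
        ∑ n ∈ S, (r ^ n * ‖c n‖) ^ 2 := by
      intro S
      rw [ho.norm_sum (fun n => ((r : ℂ) ^ n) • c n) S]
      refine Finset.sum_congr rfl fun n _ => ?_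
      rw [norm_smul, norm_pow, Complex.norm_real, Real.norm_eq_abs, abs_of_nonneg hr]
    have hlim := (hL.norm.pow 2)
    refine le_trans ?_ (pow_le_pow_left₀ (norm_nonneg _) hn 2)
    refine ge_of_tendsto hlim ?_
    filter_upwards [eventually_ge_atTop S] with S' hS'
    rw [hs]
    exact Finset.sum_le_sum_of_subset_of_nonneg hS' fun _ _ _ => by positivity
  have hcont : Tendsto (fun r : ℝ => ∑ n ∈ S, (r ^ n * ‖c n‖) ^ 2) (𝓝[<] 1)
      (𝓝 (∑ n ∈ S, ‖c n‖ ^ 2)) := by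
    have : Continuous fun r : ℝ => ∑ n ∈ S, (r ^ n * ‖c n‖) ^ 2 := by fun_prop
    simpa using (this.tendsto 1).mono_left nhdsWithin_le_nhds
  refine le_of_tendsto hcont ?_
  filter_upwards [Ioo_mem_nhdsLT (show (0 : ℝ) < 1 by norm_num)] with r hr
  exact key r hr.1.le hr.2

/-- **Fatou's theorem** for power series with square summable coefficients. -/
theorem exists_radial_limit {c : ℕ → F} (hc : Summable fun n => ‖c n‖ ^ 2) :
    ∃ b : L2 F, (∀ n : ℕ, fourierCoeff b n = c n) ∧ (∀ n < 0, fourierCoeff b n = 0) ∧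
      ∀ᵐ t ∂(haarAddCircle : Measure Circ),
        Tendsto (fun r : ℝ => ∑' n : ℕ, ((r : ℂ) ^ n * fourier n t) • c n) (𝓝[<] 1) (𝓝 (b t)) := by
  have ho := (orthogonalFamily_monomial (E := F)).comp Nat.cast_injective
  -- The boundary function is the `L²` sum of the monomials; its Poisson integral is the given power
  -- series.
  have hs : Summable fun n : ℕ => monomial F n (c n) := (ho.summable_iff_norm_sq_summable c).2 hc
  have hcoef : ∀ m : ℤ, HasSum (fun n : ℕ => if m = n then c n else 0)
      (fourierCoeff (∑' n : ℕ, monomial F n (c n) : L2 F) m) := by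
    intro m
    have := (fourierCoeffL F m).hasSum hs.hasSum
    simpa only [fourierCoeffL_apply, Function.comp_def, fourierCoeff_monomial] using this
  have h1 : ∀ n : ℕ, fourierCoeff (∑' n : ℕ, monomial F n (c n) : L2 F) n = c n := by
    intro n
    refine (hcoef n).unique ?_
    convert hasSum_single n ?_ using 1
    · simp
    · intro m hm
      rw [if_neg]
      exact_mod_cast hm.symm
  have h2 : ∀ n < 0, fourierCoeff (∑' n : ℕ, monomial F n (c n) : L2 F) n = 0 := by
    intro m hm
    refine (hcoef m).unique ?_
    convert hasSum_zero with n
    rw [if_neg]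
    omega
  refine ⟨_, h1, h2, ?_⟩
  filter_upwards [ae_tendsto_poisson_integral
    (integrable_L2 (∑' n : ℕ, monomial F n (c n) : L2 F))] with t ht
  refine ht.congr' ?_
  filter_upwards [Ioo_mem_nhdsLT (show (0 : ℝ) < 1 by norm_num)] with r hr
  rw [← (hasSum_poisson_integral hr.1.le hr.2 (integrable_L2 _) h2 t).tsum_eq]
  simp_rw [h1]

end HardySeries

/-! ### Boundary values and multiplication operators -/

section BoundaryValue

variable {E F : Type*} [NormedAddCommGroup E] [InnerProductSpace ℂ E]
  [NormedAddCommGroup F] [InnerProductSpace ℂ F] [CompleteSpace F] {Θ : ℂ → E →L[ℂ] F}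

theorem ofReal_mul_toCircle_mem_ball {r : ℝ} (hr : 0 ≤ r) (hr1 : r < 1) (t : Circ) :
    (r : ℂ) * (toCircle t : ℂ) ∈ Metric.ball (0 : ℂ) 1 := by
  rw [mem_ball_zero_iff, norm_mul, Circle.norm_coe, Complex.norm_real, Real.norm_eq_abs,
    abs_of_nonneg hr, mul_one]
  exact hr1

theorem ofReal_mul_toCircle_pow (r : ℝ) (t : Circ) (n : ℕ) :
    ((r : ℂ) * (toCircle t : ℂ)) ^ n = (r : ℂ) ^ n * fourier n t := by
  rw [mul_pow, fourier_apply, natCast_zsmul, toCircle_nsmul, Circle.coe_pow]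

omit [CompleteSpace F] in
-- Abel's argument: convergence at some `q` between `r` and `1` bounds `qⁿ ‖c n‖`, leaving the
-- geometric ratio `r / q`.
theorem summable_pow_mul_norm {c : ℕ → F} (hc : ∀ z ∈ Metric.ball (0 : ℂ) 1,
    Summable fun n => z ^ n • c n) {r : ℝ} (hr : 0 ≤ r) (hr1 : r < 1) :
    Summable fun n => r ^ n * ‖c n‖ := by
  obtain ⟨q, hq, hq1⟩ := exists_between hr1
  have hq0 : 0 < q := hr.trans_lt hq
  have h := (hc q (by simpa [abs_of_pos hq0] using hq1)).tendsto_atTop_zero.norm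
  obtain ⟨C, hC⟩ := h.bddAbove_range
  have hC' : ∀ n, q ^ n * ‖c n‖ ≤ C := fun n => by
    have := hC ⟨n, rfl⟩
    simpa [norm_smul, abs_of_pos hq0] using this
  refine Summable.of_nonneg_of_le (fun n => by positivity) (fun n => ?_)
    ((summable_geometric_of_lt_one (r := r / q) (by positivity)
      ((div_lt_one hq0).2 hq)).mul_right C)
  calc r ^ n * ‖c n‖ = (r / q) ^ n * (q ^ n * ‖c n‖) := by
        rw [div_pow]; field_simp
    _ ≤ _ := mul_le_mul_of_nonneg_left (hC' n) (by positivity)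

/-- The coefficients of a contractive analytic function are contractions, square summable at
every vector. -/
theorem sum_norm_sq_coeff_le {a : ℕ → E →L[ℂ] F}
    (ha : ∀ z ∈ Metric.ball (0 : ℂ) 1, ∀ e : E, HasSum (fun n => z ^ n • a n e) (Θ z e))
    (hΘ : ∀ z ∈ Metric.ball (0 : ℂ) 1, ‖Θ z‖ ≤ 1) (e : E) (S : Finset ℕ) :
    ∑ n ∈ S, ‖a n e‖ ^ 2 ≤ ‖e‖ ^ 2 := by
  refine sum_norm_sq_le_of_bounded (c := fun n => a n e) (fun r hr hr1 =>
    summable_pow_mul_norm (fun z hz => (ha z hz e).summable) hr hr1) (fun r hr hr1 t => ?_) S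
  have hz := ofReal_mul_toCircle_mem_ball hr hr1 t
  have h := (ha _ hz e).tsum_eq
  simp_rw [ofReal_mul_toCircle_pow] at h
  rw [h]
  exact ((Θ _).le_opNorm e).trans (mul_le_of_le_one_left (norm_nonneg _) (hΘ _ hz))

theorem norm_coeff_apply_le {a : ℕ → E →L[ℂ] F}
    (ha : ∀ z ∈ Metric.ball (0 : ℂ) 1, ∀ e : E, HasSum (fun n => z ^ n • a n e) (Θ z e))
    (hΘ : ∀ z ∈ Metric.ball (0 : ℂ) 1, ‖Θ z‖ ≤ 1) (n : ℕ) (e : E) : ‖a n e‖ ≤ ‖e‖ := by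
  have := sum_norm_sq_coeff_le ha hΘ e {n}
  rw [Finset.sum_singleton] at this
  exact (sq_le_sq₀ (norm_nonneg _) (norm_nonneg _)).1 this

omit [CompleteSpace F] in
theorem IsContractiveAnalytic.norm_apply_le (hΘ : IsContractiveAnalytic Θ) {z : ℂ}
    (hz : z ∈ Metric.ball (0 : ℂ) 1) (e : E) : ‖Θ z e‖ ≤ ‖e‖ :=
  ((Θ z).le_opNorm e).trans (mul_le_of_le_one_left (norm_nonneg _) (hΘ.2 z hz))

/-- The coefficients applied to `e` are square summable, so Fatou's theorem applies. The exceptional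
null set still depends on `e`. -/
theorem IsContractiveAnalytic.ae_radial_limit (hΘ : IsContractiveAnalytic Θ) (e : E) :
    ∀ᵐ t ∂(haarAddCircle : Measure Circ), ∃ y,
      Tendsto (fun r : ℝ => Θ ((r : ℂ) * (toCircle t : ℂ)) e) (𝓝[<] 1) (𝓝 y) := by
  obtain ⟨⟨a, ha⟩, hc⟩ := hΘ
  have hs : Summable fun n => ‖a n e‖ ^ 2 :=
    summable_of_sum_le (fun _ => by positivity) (sum_norm_sq_coeff_le ha hc e)
  obtain ⟨b, -, -, hb⟩ := exists_radial_limit hs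
  filter_upwards [hb] with t ht
  refine ⟨b t, ht.congr' ?_⟩
  filter_upwards [Ioo_mem_nhdsLT (show (0 : ℝ) < 1 by norm_num)] with r hr
  rw [← (ha _ (ofReal_mul_toCircle_mem_ball hr.1.le hr.2 t) e).tsum_eq]
  simp_rw [ofReal_mul_toCircle_pow]

/-- Pointwise convergence of contractions on a dense set implies pointwise convergence. -/
theorem exists_tendsto_of_dense {ι : Type*} {l : Filter ι} [l.NeBot] {T : ι → E →L[ℂ] F}
    (hT : ∀ᶠ i in l, ∀ e, ‖T i e‖ ≤ ‖e‖) {D : Set E} (hD : Dense D)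
    (h : ∀ d ∈ D, ∃ y, Tendsto (fun i => T i d) l (𝓝 y)) (e : E) :
    ∃ y, Tendsto (fun i => T i e) l (𝓝 y) := by
  rw [← cauchy_map_iff_exists_tendsto, Metric.cauchy_iff]
  refine ⟨inferInstance, fun ε hε => ?_⟩
  obtain ⟨d, hd, hde⟩ := hD.exists_dist_lt e (show 0 < ε / 4 by positivity)
  obtain ⟨y, hy⟩ := h d hd
  refine ⟨_, image_mem_map (hT.and (Metric.tendsto_nhds.1 hy (ε / 4) (by positivity))), ?_⟩
  have key : ∀ i, (∀ e, ‖T i e‖ ≤ ‖e‖) ∧ dist (T i d) y < ε / 4 → dist (T i e) y < ε / 2 := by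
    rintro i ⟨h1, h2⟩
    have h3 : dist (T i e) (T i d) ≤ dist e d := by
      rw [dist_eq_norm, dist_eq_norm, ← map_sub]
      exact h1 _
    linarith [dist_triangle (T i e) (T i d) y]
  rintro _ ⟨i, hi, rfl⟩ _ ⟨j, hj, rfl⟩
  linarith [key i hi, key j hj, dist_triangle_right (T i e) (T j e) y]

omit [CompleteSpace F] in
theorem eventually_norm_apply_le (hΘ : IsContractiveAnalytic Θ) (t : Circ) :
    ∀ᶠ r : ℝ in 𝓝[<] 1, ∀ e, ‖Θ ((r : ℂ) * (toCircle t : ℂ)) e‖ ≤ ‖e‖ := by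
  filter_upwards [Ioo_mem_nhdsLT (show (0 : ℝ) < 1 by norm_num)] with r hr e
  exact hΘ.norm_apply_le (ofReal_mul_toCircle_mem_ball hr.1.le hr.2 t) e

variable [TopologicalSpace.SeparableSpace E]

/-- The boundary values of a contractive analytic function exist almost everywhere. -/
theorem IsContractiveAnalytic.ae_tendsto_boundaryValue (hΘ : IsContractiveAnalytic Θ) :
    ∀ᵐ t ∂(haarAddCircle : Measure Circ), ∀ e : E,
      Tendsto (fun r : ℝ => Θ ((r : ℂ) * (toCircle t : ℂ)) e) (𝓝[<] 1)
        (𝓝 (boundaryValue Θ t e)) := by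
  -- A dense sequence leaves one common null set; contractivity extends convergence to all vectors.
  have h := ae_all_iff.2 fun n : ℕ => hΘ.ae_radial_limit (TopologicalSpace.denseSeq E n)
  filter_upwards [h] with t ht
  have h1 := exists_tendsto_of_dense (eventually_norm_apply_le hΘ t)
    (TopologicalSpace.denseRange_denseSeq E) (by rintro _ ⟨n, rfl⟩; exact ht n)
  choose A hA using h1
  have hA' : ∃ A : E →L[ℂ] F, ∀ e : E,
      Tendsto (fun r : ℝ => Θ ((r : ℂ) * (toCircle t : ℂ)) e) (𝓝[<] 1) (𝓝 (A e)) := by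
    refine ⟨LinearMap.mkContinuous (linearMapOfTendsto A
      (fun r : ℝ => (Θ ((r : ℂ) * (toCircle t : ℂ)) : E →ₗ[ℂ] F)) (l := 𝓝[<] 1)
      (tendsto_pi_nhds.2 hA)) 1 fun e => ?_, hA⟩
    rw [one_mul]
    exact le_of_tendsto (hA e).norm ((eventually_norm_apply_le hΘ t).mono fun r hr => hr e)
  rw [boundaryValue, dif_pos hA']
  exact hA'.choose_spec

theorem IsContractiveAnalytic.ae_norm_boundaryValue_le (hΘ : IsContractiveAnalytic Θ) :
    ∀ᵐ t ∂(haarAddCircle : Measure Circ), ∀ e : E, ‖boundaryValue Θ t e‖ ≤ ‖e‖ := by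
  filter_upwards [hΘ.ae_tendsto_boundaryValue] with t ht e
  exact le_of_tendsto (ht e).norm ((eventually_norm_apply_le hΘ t).mono fun r hr => hr e)

omit [TopologicalSpace.SeparableSpace E] in
-- The coefficients are contractions, so inside the disc the series converges in operator norm,
-- uniformly on the circle. The purpose is measurability of `t ↦ Θ(r e^{it}) v(t)`.
theorem IsContractiveAnalytic.continuous_circle (hΘ : IsContractiveAnalytic Θ) {r : ℝ}
    (hr : 0 ≤ r) (hr1 : r < 1) : Continuous fun t : Circ => Θ ((r : ℂ) * (toCircle t : ℂ)) := by
  obtain ⟨⟨a, ha⟩, hc⟩ := hΘ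
  have hb : ∀ (n : ℕ) (t : Circ), ‖((r : ℂ) ^ n * fourier n t) • a n‖ ≤ r ^ n := by
    intro n t
    rw [norm_smul, norm_mul, norm_fourier_apply, norm_pow, Complex.norm_real, Real.norm_eq_abs,
      abs_of_nonneg hr, mul_one]
    refine mul_le_of_le_one_right (by positivity) ?_
    exact (a n).opNorm_le_bound zero_le_one fun e => by
      rw [one_mul]; exact norm_coeff_apply_le ha hc n e
  have hs := summable_geometric_of_lt_one hr hr1
  have heq : (fun t : Circ => Θ ((r : ℂ) * (toCircle t : ℂ))) =
      fun t : Circ => ∑' n : ℕ, ((r : ℂ) ^ n * fourier n t) • a n := by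
    funext t
    ext e
    have h1 := ha _ (ofReal_mul_toCircle_mem_ball hr hr1 t) e
    have h2 := (ContinuousLinearMap.apply ℂ F e).hasSum
      (Summable.of_norm_bounded hs fun n => hb n t).hasSum
    simp_rw [ofReal_mul_toCircle_pow] at h1
    exact h1.unique h2
  rw [heq]
  exact continuous_tsum (fun n => by fun_prop) hs hb

theorem tendsto_one_sub_inv_nat : Tendsto (fun n : ℕ => (1 : ℝ) - 1 / ((n : ℝ) + 1)) atTop (𝓝[<] 1) := by
  refine tendsto_nhdsWithin_iff.2 ⟨?_, Eventually.of_forall fun n => ?_⟩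
  · simpa using (tendsto_const_nhds (x := (1 : ℝ))).sub tendsto_one_div_add_atTop_nhds_zero_nat
  · have : (0 : ℝ) < 1 / ((n : ℝ) + 1) := by positivity
    simpa using this

theorem one_sub_inv_nat_mem (n : ℕ) :
    0 ≤ (1 : ℝ) - 1 / ((n : ℝ) + 1) ∧ (1 : ℝ) - 1 / ((n : ℝ) + 1) < 1 := by
  have h : (0 : ℝ) < 1 / ((n : ℝ) + 1) := by positivity
  have h' : 1 / ((n : ℝ) + 1) ≤ 1 := by
    rw [div_le_one (by positivity)]; linarith [n.cast_nonneg (α := ℝ)]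
  constructor <;> linarith

theorem IsContractiveAnalytic.aestronglyMeasurable_boundaryValue (hΘ : IsContractiveAnalytic Θ)
    {v : Circ → E} (hv : AEStronglyMeasurable v haarAddCircle) :
    AEStronglyMeasurable (fun t => boundaryValue Θ t (v t)) haarAddCircle := by
  refine aestronglyMeasurable_of_tendsto_ae atTop
    (f := fun (n : ℕ) t => Θ (((1 - 1 / ((n : ℝ) + 1) : ℝ) : ℂ) * (toCircle t : ℂ)) (v t))
    (fun n => ?_) ?_
  · obtain ⟨h0, h1⟩ := one_sub_inv_nat_mem n
    have hc := (hΘ.continuous_circle h0 h1).aestronglyMeasurable (μ := (haarAddCircle : Measure Circ))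
    exact (ContinuousLinearMap.id ℂ (E →L[ℂ] F)).aestronglyMeasurable_comp₂ hc hv
  · filter_upwards [hΘ.ae_tendsto_boundaryValue] with t ht
    exact (ht (v t)).comp tendsto_one_sub_inv_nat

theorem IsContractiveAnalytic.memLp_boundaryValue (hΘ : IsContractiveAnalytic Θ) (v : L2 E) :
    MemLp (fun t => boundaryValue Θ t (v t)) 2 (haarAddCircle : Measure Circ) := by
  refine (Lp.memLp v).of_le (hΘ.aestronglyMeasurable_boundaryValue (Lp.aestronglyMeasurable v)) ?_
  filter_upwards [hΘ.ae_norm_boundaryValue_le] with t ht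
  exact ht _

/-- This rules out the default value `0` in `mulOp`. -/
theorem IsContractiveAnalytic.exists_mulOp (hΘ : IsContractiveAnalytic Θ) :
    ∃ M : L2 E →L[ℂ] L2 F, ∀ v : L2 E,
      M v =ᵐ[haarAddCircle] fun t => boundaryValue Θ t (v t) := by
  let L : L2 E →ₗ[ℂ] L2 F :=
    { toFun := fun v => (hΘ.memLp_boundaryValue v).toLp _
      map_add' := fun v w => by
        ext1
        filter_upwards [(hΘ.memLp_boundaryValue v).coeFn_toLp, (hΘ.memLp_boundaryValue w).coeFn_toLp,
          (hΘ.memLp_boundaryValue (v + w)).coeFn_toLp, Lp.coeFn_add v w,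
          Lp.coeFn_add ((hΘ.memLp_boundaryValue v).toLp _) ((hΘ.memLp_boundaryValue w).toLp _)]
          with t h1 h2 h3 h4 h5
        rw [h3, h5, Pi.add_apply, h1, h2, h4, Pi.add_apply, map_add]
      map_smul' := fun c v => by
        ext1
        filter_upwards [(hΘ.memLp_boundaryValue v).coeFn_toLp,
          (hΘ.memLp_boundaryValue (c • v)).coeFn_toLp, Lp.coeFn_smul c v,
          Lp.coeFn_smul c ((hΘ.memLp_boundaryValue v).toLp _)]
          with t h1 h2 h3 h4
        rw [h2, RingHom.id_apply, h4, Pi.smul_apply, h1, h3, Pi.smul_apply, map_smul] }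
  refine ⟨L.mkContinuous 1 fun v => ?_, fun v => (hΘ.memLp_boundaryValue v).coeFn_toLp⟩
  rw [one_mul]
  refine Lp.norm_le_norm_of_ae_le ?_
  filter_upwards [hΘ.ae_norm_boundaryValue_le, (hΘ.memLp_boundaryValue v).coeFn_toLp] with t ht h1
  change ‖((hΘ.memLp_boundaryValue v).toLp _ : L2 F) t‖ ≤ _
  rw [h1]
  exact ht _

theorem IsContractiveAnalytic.coeFn_mulOp (hΘ : IsContractiveAnalytic Θ) (v : L2 E) :
    mulOp Θ v =ᵐ[haarAddCircle] fun t => boundaryValue Θ t (v t) := by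
  rw [mulOp, dif_pos hΘ.exists_mulOp]
  exact hΘ.exists_mulOp.choose_spec v

theorem IsContractiveAnalytic.norm_mulOp_le (hΘ : IsContractiveAnalytic Θ) (v : L2 E) :
    ‖mulOp Θ v‖ ≤ ‖v‖ := by
  refine Lp.norm_le_norm_of_ae_le ?_
  filter_upwards [hΘ.ae_norm_boundaryValue_le, hΘ.coeFn_mulOp v] with t ht h1
  rw [h1]
  exact ht _

variable [CompleteSpace E]

theorem IsContractiveAnalytic.mulOp_expMul (hΘ : IsContractiveAnalytic Θ) (n : ℤ) (v : L2 E) :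
    mulOp Θ (expMul E n v) = expMul F n (mulOp Θ v) := by
  ext1
  filter_upwards [hΘ.coeFn_mulOp (expMul E n v), hΘ.coeFn_mulOp v, coeFn_expMul n v,
    coeFn_expMul n (mulOp Θ v)] with t h1 h2 h3 h4
  rw [h1, h3, h4, h2, map_smul]

/-- Multiplication by a contractive analytic function maps `H²(E)` into `H²(F)`. -/
theorem IsContractiveAnalytic.mulOp_mem_H2 (hΘ : IsContractiveAnalytic Θ) {u : L2 E}
    (hu : u ∈ H2 E) : mulOp Θ u ∈ H2 F := by
  rw [mem_H2_iff] at hu ⊢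
  intro m hm
  -- For `r < 1` the `n`-th term of the series contributes `rⁿ a_n` applied to the coefficient of
  -- `u` of index `m - n < 0`.
  have h0 : ∀ r : ℝ, 0 ≤ r → r < 1 →
      ∫ t : Circ, (fourier (-m) t : ℂ) • Θ ((r : ℂ) * (toCircle t : ℂ)) (u t) ∂haarAddCircle = 0 := by
    intro r hr hr1
    obtain ⟨⟨a, ha⟩, hc⟩ := hΘ
    have hint : ∀ n : ℕ, Integrable (fun t : Circ => (fourier (-(m - n)) t : ℂ) • u t)
        haarAddCircle := fun n => (integrable_L2 u).fourier_smul _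
    have hterm : ∀ (n : ℕ) (t : Circ), (fourier (-m) t : ℂ) • ((r : ℂ) ^ n * fourier n t) • a n (u t) =
        (r : ℂ) ^ n • a n ((fourier (-(m - n)) t : ℂ) • u t) := by
      intro n t
      rw [map_smul, ← mul_smul, ← mul_smul, neg_sub, sub_eq_add_neg, fourier_add]
      congr 1
      ring
    have key := hasSum_integral_of_dominated_convergence (μ := (haarAddCircle : Measure Circ))
      (F := fun (n : ℕ) (t : Circ) => (fourier (-m) t : ℂ) • ((r : ℂ) ^ n * fourier n t) • a n (u t))
      (f := fun t => (fourier (-m) t : ℂ) • Θ ((r : ℂ) * (toCircle t : ℂ)) (u t))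
      (fun n t => r ^ n * ‖u t‖) ?_ ?_ ?_ ?_ ?_
    · refine key.unique ?_
      convert hasSum_zero with n
      simp_rw [hterm]
      rw [integral_smul, (a n).integral_comp_comm (hint n)]
      have := hu (m - n) (by omega)
      rw [fourierCoeff] at this
      rw [this, map_zero, smul_zero]
    · intro n
      simp_rw [hterm]
      exact (((a n).integrable_comp (hint n)).smul ((r : ℂ) ^ n)).aestronglyMeasurable
    · refine fun n => Eventually.of_forall fun t => ?_
      rw [norm_smul, norm_smul, norm_mul, norm_fourier_apply, norm_fourier_apply, norm_pow,
        Complex.norm_real, Real.norm_eq_abs, abs_of_nonneg hr, one_mul, mul_one]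
      exact mul_le_mul_of_nonneg_left (norm_coeff_apply_le ha hc n _) (by positivity)
    · exact Eventually.of_forall fun t => (summable_geometric_of_lt_one hr hr1).mul_right _
    · simp_rw [tsum_mul_right]
      exact (integrable_L2 u).norm.const_mul _
    · refine Eventually.of_forall fun t => ?_
      have := ha _ (ofReal_mul_toCircle_mem_ball hr hr1 t) (u t)
      simp_rw [ofReal_mul_toCircle_pow] at this
      exact this.const_smul _
  -- Let `r → 1` along a sequence, with majorant `‖u t‖`.
  have hlim : Tendsto (fun n : ℕ => ∫ t : Circ, (fourier (-m) t : ℂ) •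
      Θ (((1 - 1 / ((n : ℝ) + 1) : ℝ) : ℂ) * (toCircle t : ℂ)) (u t) ∂haarAddCircle) atTop
      (𝓝 (∫ t : Circ, (fourier (-m) t : ℂ) • boundaryValue Θ t (u t) ∂haarAddCircle)) := by
    refine tendsto_integral_of_dominated_convergence (fun t => ‖u t‖) (fun n => ?_)
      (integrable_L2 u).norm (fun n => Eventually.of_forall fun t => ?_) ?_
    · obtain ⟨h0, h1⟩ := one_sub_inv_nat_mem n
      have hc := (hΘ.continuous_circle h0 h1).aestronglyMeasurable
        (μ := (haarAddCircle : Measure Circ))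
      exact (map_continuous (fourier (-m))).aestronglyMeasurable.smul
        ((ContinuousLinearMap.id ℂ (E →L[ℂ] F)).aestronglyMeasurable_comp₂ hc
          (Lp.aestronglyMeasurable u))
    · obtain ⟨h0, h1⟩ := one_sub_inv_nat_mem n
      rw [norm_smul, norm_fourier_apply, one_mul]
      exact hΘ.norm_apply_le (ofReal_mul_toCircle_mem_ball h0 h1 t) _
    · filter_upwards [hΘ.ae_tendsto_boundaryValue] with t ht
      exact ((ht (u t)).comp tendsto_one_sub_inv_nat).const_smul _
  have h1 : fourierCoeff (mulOp Θ u) m =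
      ∫ t : Circ, (fourier (-m) t : ℂ) • boundaryValue Θ t (u t) ∂haarAddCircle := by
    refine integral_congr_ae ?_
    filter_upwards [hΘ.coeFn_mulOp u] with t ht
    rw [ht]
  rw [h1]
  refine tendsto_nhds_unique hlim ?_
  simp_rw [fun n : ℕ => h0 _ (one_sub_inv_nat_mem n).1 (one_sub_inv_nat_mem n).2]
  exact tendsto_const_nhds

end BoundaryValue

/-! ### Multiplicativity of boundary values -/

section Product

variable {k : ℕ} {E : Fin (k + 1) → Type*} [∀ i, NormedAddCommGroup (E i)]
  [∀ i, InnerProductSpace ℂ (E i)] [∀ i, CompleteSpace (E i)]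
  [∀ i, TopologicalSpace.SeparableSpace (E i)]
  {Θ : ℂ → E 0 →L[ℂ] E (Fin.last k)} {Θs : ∀ j : Fin k, ℂ → E j.castSucc →L[ℂ] E j.succ}

/-- The multiplication operator of a product is the product of the multiplication operators. -/
theorem mulOp_eq_mulProd (hΘ : IsContractiveAnalytic Θ) (hΘs : ∀ j, IsContractiveAnalytic (Θs j))
    (hfac : ∀ z ∈ Metric.ball (0 : ℂ) 1, Θ z = chainProd (fun j => Θs j z) 0 (Fin.last k))
    (v : L2 (E 0)) : mulOp Θ v = mulProd Θs 0 (Fin.last k) v := by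
  have key : ∀ m : Fin (k + 1), ∀ᵐ t ∂(haarAddCircle : Measure Circ),
      Tendsto (fun r : ℝ => chainProd (fun j => Θs j ((r : ℂ) * (toCircle t : ℂ))) 0 m (v t))
        (𝓝[<] 1) (𝓝 (mulProd Θs 0 m v t)) := by
    intro m
    induction m using Fin.induction with
    | zero =>
      refine Eventually.of_forall fun t => ?_
      simp only [mulProd, chainProd_self]
      exact tendsto_const_nhds
    | succ m ih =>
      have h1 : mulProd Θs 0 m.succ v = mulOp (Θs m) (mulProd Θs 0 m.castSucc v) := by
        rw [mulProd, chainProd_succ _ _ _ (Fin.zero_le _)]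
        rfl
      rw [h1]
      filter_upwards [ih, (hΘs m).ae_tendsto_boundaryValue,
        (hΘs m).coeFn_mulOp (mulProd Θs 0 m.castSucc v)] with t h2 h3 h4
      rw [h4]
      simp_rw [fun z : ℂ => chainProd_succ (fun j => Θs j z) 0 m (Fin.zero_le _)]
      have h5 := h3 (mulProd Θs 0 m.castSucc v t)
      -- Strong limits multiply because the outer factors are contractions: the error in the inner
      -- vector is not enlarged.
      have h6 : Tendsto (fun r : ℝ => Θs m ((r : ℂ) * (toCircle t : ℂ))
          (chainProd (fun j => Θs j ((r : ℂ) * (toCircle t : ℂ))) 0 m.castSucc (v t) -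
            mulProd Θs 0 m.castSucc v t)) (𝓝[<] 1) (𝓝 0) := by
        have h7 : Tendsto (fun r : ℝ => ‖chainProd (fun j => Θs j ((r : ℂ) * (toCircle t : ℂ))) 0
            m.castSucc (v t) - mulProd Θs 0 m.castSucc v t‖) (𝓝[<] 1) (𝓝 0) := by
          simpa using (h2.sub_const (mulProd Θs 0 m.castSucc v t)).norm
        refine squeeze_zero_norm' ?_ h7
        filter_upwards [eventually_norm_apply_le (hΘs m) t] with r hr
        exact hr _
      have h8 := h6.add h5
      rw [zero_add] at h8
      refine h8.congr fun r => ?_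
      rw [map_sub, sub_add_cancel]
      rfl
  ext1
  filter_upwards [key (Fin.last k), hΘ.ae_tendsto_boundaryValue, hΘ.coeFn_mulOp v] with t h1 h2 h3
  rw [h3]
  refine tendsto_nhds_unique (h2 (v t)) (h1.congr' ?_)
  filter_upwards [Ioo_mem_nhdsLT (show (0 : ℝ) < 1 by norm_num)] with r hr
  rw [hfac _ (ofReal_mul_toCircle_mem_ball hr.1.le hr.2 t)]

end Product

/-! ### Defect spaces -/

section Defect

variable {X Y : Type*} [NormedAddCommGroup X] [InnerProductSpace ℂ X] [CompleteSpace X]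
  [NormedAddCommGroup Y] [InnerProductSpace ℂ Y] [CompleteSpace Y]

theorem coe_defectVec (A : X →L[ℂ] Y) (f : X) : (defectVec A f : X) = defectOp A f := rfl

theorem denseRange_defectVec (A : X →L[ℂ] Y) : DenseRange (defectVec A) := by
  intro x
  rw [closure_subtype]
  have h : (x : X) ∈ closure (LinearMap.range (defectOp A).toLinearMap : Set X) := x.2
  convert h using 2
  ext y
  simp [defectVec]

theorem map_mem_defectSpace {A : X →L[ℂ] Y} {U : X →L[ℂ] X}
    (hU : ∀ x, defectOp A (U x) = U (defectOp A x)) {v : X} (hv : v ∈ defectSpace A) :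
    U v ∈ defectSpace A := by
  have h : defectSpace A ≤ (defectSpace A).comap U.toLinearMap := by
    refine Submodule.topologicalClosure_minimal _ ?_
      ((isClosed_defectSpace A).preimage U.continuous)
    rintro _ ⟨x, rfl⟩
    refine Submodule.le_topologicalClosure _ ⟨U x, ?_⟩
    exact hU x
  exact h hv

end Defect

/-! ### The model operator as a compression of the forward shift -/

section Model

variable {E F : Type*} [NormedAddCommGroup E] [InnerProductSpace ℂ E] [CompleteSpace E]
  [NormedAddCommGroup F] [InnerProductSpace ℂ F] [CompleteSpace F] {Θ : ℂ → E →L[ℂ] F}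

theorem expMul_mem_H2 {u : L2 E} (hu : u ∈ H2 E) : expMul E 1 u ∈ H2 E := by
  rw [mem_H2_iff] at hu ⊢
  intro n hn
  rw [fourierCoeff_expMul]
  exact hu _ (by omega)

/-- Multiplication by `e^{it}` on `L²(F) ⊕ L²(E)`. -/
def forwardShift (E F : Type*) [NormedAddCommGroup E] [InnerProductSpace ℂ E] [CompleteSpace E]
    [NormedAddCommGroup F] [InnerProductSpace ℂ F] [CompleteSpace F] :
    WithLp 2 (L2 F × L2 E) →L[ℂ] WithLp 2 (L2 F × L2 E) :=
  (WithLp.prodContinuousLinearEquiv 2 ℂ (L2 F) (L2 E)).symm.toContinuousLinearMap ∘L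
    (expMul F 1).prodMap (expMul E 1) ∘L
    (WithLp.prodContinuousLinearEquiv 2 ℂ (L2 F) (L2 E)).toContinuousLinearMap

theorem forwardShift_apply (x : WithLp 2 (L2 F × L2 E)) :
    forwardShift E F x = WithLp.toLp 2 (expMul F 1 x.fst, expMul E 1 x.snd) := rfl

theorem modelSpace_le_modelAmbient : modelSpace Θ ≤ modelAmbient Θ := inf_le_left

/-- The adjoint of the model operator is the restriction of the backward shift, whence the model
operator is the compression of the forward shift. -/
theorem inner_modelOp (x y : modelSpace Θ) :
    ⟪(modelOp Θ x : WithLp 2 (L2 F × L2 E)), y⟫_ℂ =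
      ⟪forwardShift E F x, (y : WithLp 2 (L2 F × L2 E))⟫_ℂ := by
  rw [← Submodule.coe_inner, modelOp, ContinuousLinearMap.adjoint_inner_left, modelAdjoint]
  change ⟪x, (modelSpace Θ).orthogonalProjectionOnto (modelShift E F y)⟫_ℂ = _
  -- Paired with a vector of the model space, the projection in `modelAdjoint` disappears;
  -- invariance under the backward shift is not required.
  rw [Submodule.inner_orthogonalProjectionOnto_eq_of_mem_left]
  have hx : (x : WithLp 2 (L2 F × L2 E)).fst ∈ H2 F := (modelSpace_le_modelAmbient x.2).1
  have hy : (y : WithLp 2 (L2 F × L2 E)) = WithLp.toLp 2 (y.1.fst, y.1.snd) := rfl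
  rw [hy, modelShift_apply, forwardShift_apply, WithLp.prod_inner_apply, WithLp.prod_inner_apply]
  change ⟪x.1.fst, expMul F (-1) (y.1.fst - constL F (fourierCoeff y.1.fst 0))⟫_ℂ +
    ⟪x.1.snd, expMul E (-1) y.1.snd⟫_ℂ =
    ⟪expMul F 1 x.1.fst, y.1.fst⟫_ℂ + ⟪expMul E 1 x.1.snd, y.1.snd⟫_ℂ
  -- The constant term of `e^{it} x` is the coefficient of `x` of index `-1`, which vanishes on
  -- `H²`.
  have h0 : ⟪expMul F 1 x.1.fst, constL F (fourierCoeff y.1.fst 0)⟫_ℂ = 0 := by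
    rw [← inner_conj_symm, inner_constL, fourierCoeff_expMul, (mem_H2_iff _).1 hx _ (by norm_num),
      inner_zero_right, map_zero]
  rw [← inner_expMul_left, ← inner_expMul_left, inner_sub_right, h0, sub_zero]

variable [TopologicalSpace.SeparableSpace E]

theorem IsContractiveAnalytic.defectOp_expMul (hΘ : IsContractiveAnalytic Θ) (n : ℤ) (v : L2 E) :
    defectOp (mulOp Θ) (expMul E n v) = expMul E n (defectOp (mulOp Θ) v) := by
  refine defectOp_intertwine (V := expMul F n) ?_ ?_ ?_ v
  · ext1 f
    rw [adjoint_expMul, ContinuousLinearMap.comp_apply, expMul_expMul, neg_add_cancel, expMul_zero]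
    rfl
  · ext1 f
    rw [adjoint_expMul, ContinuousLinearMap.comp_apply, expMul_expMul, add_neg_cancel, expMul_zero]
    rfl
  · ext1 f
    exact hΘ.mulOp_expMul n f

theorem IsContractiveAnalytic.expMul_mem_defectSpace (hΘ : IsContractiveAnalytic Θ) (n : ℤ)
    {v : L2 E} (hv : v ∈ defectSpace (mulOp Θ)) : expMul E n v ∈ defectSpace (mulOp Θ) :=
  map_mem_defectSpace (hΘ.defectOp_expMul n) hv

theorem IsContractiveAnalytic.forwardShift_mem_modelAmbient (hΘ : IsContractiveAnalytic Θ)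
    {x : WithLp 2 (L2 F × L2 E)} (hx : x ∈ modelAmbient Θ) :
    forwardShift E F x ∈ modelAmbient Θ :=
  ⟨expMul_mem_H2 hx.1, hΘ.expMul_mem_defectSpace 1 hx.2⟩

theorem IsContractiveAnalytic.modelGraph_le_modelAmbient (hΘ : IsContractiveAnalytic Θ) :
    modelGraph Θ ≤ modelAmbient Θ := by
  rintro _ ⟨w, hw, rfl⟩
  exact ⟨hΘ.mulOp_mem_H2 hw, Submodule.le_topologicalClosure _ ⟨w, rfl⟩⟩

theorem IsContractiveAnalytic.isClosed_modelGraph (hΘ : IsContractiveAnalytic Θ) :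
    IsClosed (modelGraph Θ : Set (WithLp 2 (L2 F × L2 E))) := by
  have h := isClosed_map_of_bound
    ((WithLp.prodContinuousLinearEquiv 2 ℂ (L2 F) (L2 E)).symm.toContinuousLinearMap ∘L
      (mulOp Θ).prod (defectOp (mulOp Θ))) (isClosed_H2 (E := E)) 1 fun w _ => by
    rw [NNReal.coe_one, one_mul]
    refine (sq_le_sq₀ (norm_nonneg _) (norm_nonneg _)).1 ?_
    rw [WithLp.prod_norm_sq_eq_of_L2]
    exact (norm_sq_defectOp hΘ.norm_mulOp_le w).ge
  exact h

/-- The model operator is the forward shift modulo the graph. -/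
theorem IsContractiveAnalytic.forwardShift_sub_modelOp_mem (hΘ : IsContractiveAnalytic Θ)
    (x : modelSpace Θ) :
    forwardShift E F x - (modelOp Θ x : WithLp 2 (L2 F × L2 E)) ∈ modelGraph Θ := by
  have : CompleteSpace (modelGraph Θ) := hΘ.isClosed_modelGraph.completeSpace_coe
  set d := forwardShift E F x - (modelOp Θ x : WithLp 2 (L2 F × L2 E)) with hd
  have hdA : d ∈ modelAmbient Θ := sub_mem
    (hΘ.forwardShift_mem_modelAmbient (modelSpace_le_modelAmbient x.2))
    (modelSpace_le_modelAmbient (modelOp Θ x).2)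
  -- The part `q` of `d` orthogonal to the graph lies in the model space, to which `d` is
  -- orthogonal; so `q = 0`.
  obtain ⟨p, hp, q, hq, hpq⟩ := (modelGraph Θ).exists_add_mem_mem_orthogonal d
  have hqA : q ∈ modelAmbient Θ := by
    rw [show q = d - p by rw [hpq]; abel]
    exact sub_mem hdA (hΘ.modelGraph_le_modelAmbient hp)
  have h1 : ⟪d, q⟫_ℂ = 0 := by
    rw [hd, inner_sub_left, inner_modelOp x ⟨q, hqA, hq⟩, sub_self]
  rw [hpq, inner_add_left, Submodule.inner_right_of_mem_orthogonal hp hq, zero_add,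
    inner_self_eq_zero] at h1
  rw [hpq, h1, add_zero]
  exact hp

end Model

/-! ### The chain of subspaces from the graph to the ambient space -/

section ChainSpan

variable {k : ℕ} {E : Fin (k + 1) → Type u} [∀ i, NormedAddCommGroup (E i)]
  [∀ i, InnerProductSpace ℂ (E i)]
  {Θ : ℂ → E 0 →L[ℂ] E (Fin.last k)} {Θs : ∀ j : Fin k, ℂ → E j.castSucc →L[ℂ] E j.succ}

theorem mulProd_self (i : Fin (k + 1)) (u : L2 (E i)) : mulProd Θs i i u = u := by
  rw [mulProd, chainProd_self]
  rfl

theorem mulProd_succ {i : Fin (k + 1)} {j : Fin k} (h : i ≤ j.castSucc) (u : L2 (E i)) :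
    mulProd Θs i j.succ u = mulOp (Θs j) (mulProd Θs i j.castSucc u) := by
  rw [mulProd, chainProd_succ _ _ _ h]
  rfl

theorem mulProd_castSucc_eq (i : Fin k) {j : Fin (k + 1)} (h : i.succ ≤ j)
    (u : L2 (E i.castSucc)) : mulProd Θs i.castSucc j u = mulProd Θs i.succ j (mulOp (Θs i) u) :=
  chainProd_castSucc_eq (X := fun i => L2 (E i)) (fun j => mulOp (Θs j)) i j h u

variable [∀ i, CompleteSpace (E i)]

theorem IsRegularAnalytic.Z_defectVec (h : IsRegularAnalytic Θ Θs) (f : L2 (E 0)) (j : Fin k) :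
    h.Z (defectVec (mulOp Θ) f) j = defectVec (mulOp (Θs j)) (mulProd Θs 0 j.castSucc f) :=
  h.choose_spec f j

/-- At the top the product is empty and no component of `w` is prescribed. -/
theorem chainSpan_last (h : IsRegularAnalytic Θ Θs) :
    chainSpan h (Fin.last k) = modelAmbient Θ := by
  ext x
  constructor
  · rintro ⟨u, hu, w, -, rfl⟩
    refine ⟨?_, (h.Z.symm w).2⟩
    change mulProd Θs (Fin.last k) (Fin.last k) u ∈ H2 (E (Fin.last k))
    rwa [mulProd_self]
  · rintro ⟨h1, h2⟩
    refine ⟨x.fst, h1, h.Z ⟨x.snd, h2⟩, fun j hj => ?_, ?_⟩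
    · exact absurd hj (not_le.2 (Fin.castSucc_lt_last j))
    · rw [mulProd_self, LinearIsometryEquiv.symm_apply_apply]
      rfl

theorem fin_succ_le_castSucc_iff {i j : Fin k} : i.succ ≤ j.castSucc ↔ i < j := by
  rw [Fin.le_def, Fin.lt_def, Fin.val_succ, Fin.val_castSucc]
  omega

variable [∀ i, TopologicalSpace.SeparableSpace (E i)]

section

variable (hΘs : ∀ j, IsContractiveAnalytic (Θs j))
include hΘs

theorem mulProd_expMul {i j : Fin (k + 1)} (h : i ≤ j) (n : ℤ) (u : L2 (E i)) :
    mulProd Θs i j (expMul (E i) n u) = expMul (E j) n (mulProd Θs i j u) := by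
  induction j using Fin.induction with
  | zero =>
    obtain rfl : i = 0 := by simpa using h
    rw [mulProd_self, mulProd_self]
  | succ j ih =>
    rcases h.eq_or_lt with rfl | h
    · rw [mulProd_self, mulProd_self]
    · have h' : i ≤ j.castSucc := Fin.le_castSucc_iff.2 h
      rw [mulProd_succ h', mulProd_succ h', ih h', (hΘs j).mulOp_expMul]

theorem norm_sq_mulProd (i : Fin (k + 1)) (u : L2 (E i)) :
    ‖mulProd Θs i (Fin.last k) u‖ ^ 2 +
      ∑ j : Fin k, (if i ≤ j.castSucc then
        ‖defectOp (mulOp (Θs j)) (mulProd Θs i j.castSucc u)‖ ^ 2 else 0) = ‖u‖ ^ 2 :=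
  norm_sq_chainProd (X := fun i => L2 (E i)) (A := fun j => mulOp (Θs j))
    (fun j => (hΘs j).norm_mulOp_le) i u

/-- Replace `u` by `Θ_i u`: later components are unchanged, and the `i`-th one becomes free. -/
theorem chainSpan_castSucc_le (h : IsRegularAnalytic Θ Θs) (i : Fin k) :
    chainSpan h i.castSucc ≤ chainSpan h i.succ := by
  rintro x ⟨u, hu, w, hw, rfl⟩
  refine ⟨mulOp (Θs i) u, (hΘs i).mulOp_mem_H2 hu, w, fun j hj => ?_, ?_⟩
  · rw [hw j ((Fin.castSucc_lt_succ).le.trans hj), mulProd_castSucc_eq i hj]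
  · rw [mulProd_castSucc_eq i (Fin.le_last _)]

theorem chainSpan_mono (h : IsRegularAnalytic Θ Θs) : Monotone (chainSpan h) :=
  Fin.monotone_iff_le_succ.2 (chainSpan_castSucc_le hΘs h)

theorem isClosed_chainSpan (h : IsRegularAnalytic Θ Θs) (i : Fin (k + 1)) :
    IsClosed (chainSpan h i : Set (WithLp 2 (L2 (E (Fin.last k)) × L2 (E 0)))) := by
  let P := PiLp 2 (fun j : Fin k => defectSpace (mulOp (Θs j)))
  let dv : ∀ j : Fin k, L2 (E i) × P →L[ℂ] L2 (E j.castSucc) := fun j =>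
    defectOp (mulOp (Θs j)) ∘L mulProd Θs i j.castSucc ∘L ContinuousLinearMap.fst ℂ _ _
  let pr : ∀ j : Fin k, L2 (E i) × P →L[ℂ] L2 (E j.castSucc) := fun j =>
    (defectSpace (mulOp (Θs j))).subtypeL ∘L
      PiLp.proj 2 (𝕜 := ℂ) (fun j : Fin k => defectSpace (mulOp (Θs j))) j ∘L
      ContinuousLinearMap.snd ℂ _ _
  -- The space is the image of the closed set `S` of admissible pairs `(u, w)`. The image controls
  -- `w` since `Z` is isometric, and `u` by the telescoped norm identity.
  let S : Submodule ℂ (L2 (E i) × P) :=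
    (H2 (E i)).comap (LinearMap.fst ℂ _ _) ⊓
      ⨅ j : {j : Fin k // i ≤ j.castSucc}, LinearMap.ker (pr j - dv j).toLinearMap
  have hS : IsClosed (S : Set (L2 (E i) × P)) := by
    refine IsClosed.inter (isClosed_H2.preimage continuous_fst) ?_
    rw [Submodule.coe_iInf]
    exact isClosed_iInter fun j => (pr j - dv j).isClosed_ker
  let L : L2 (E i) × P →L[ℂ] WithLp 2 (L2 (E (Fin.last k)) × L2 (E 0)) :=
    (WithLp.prodContinuousLinearEquiv 2 ℂ _ _).symm.toContinuousLinearMap ∘L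
      (mulProd Θs i (Fin.last k)).prodMap
        ((defectSpace (mulOp Θ)).subtypeL ∘L h.Z.symm.toContinuousLinearEquiv.toContinuousLinearMap)
  have hmem : ∀ x, x ∈ S ↔ x.1 ∈ H2 (E i) ∧ ∀ j : Fin k, i ≤ j.castSucc →
      x.2 j = defectVec (mulOp (Θs j)) (mulProd Θs i j.castSucc x.1) := by
    intro x
    simp only [S, Submodule.mem_inf, Submodule.mem_iInf, Subtype.forall]
    refine and_congr Iff.rfl (forall₂_congr fun j _ => ?_)
    rw [LinearMap.mem_ker, Subtype.ext_iff (a1 := x.2 j)]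
    exact sub_eq_zero (a := pr j x) (b := dv j x)
  have hL : ∀ x ∈ S, ‖x‖ ≤ (1 : NNReal) * ‖L x‖ := by
    rintro ⟨u, w⟩ hx
    obtain ⟨-, hx⟩ := (hmem _).1 hx
    have h1 : ‖L (u, w)‖ ^ 2 = ‖mulProd Θs i (Fin.last k) u‖ ^ 2 + ‖w‖ ^ 2 := by
      rw [WithLp.prod_norm_sq_eq_of_L2]
      change _ + ‖h.Z.symm w‖ ^ 2 = _
      rw [LinearIsometryEquiv.norm_map]
      rfl
    have h2 := norm_sq_mulProd hΘs i u
    have h3 : ∑ j : Fin k, (if i ≤ j.castSucc then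
        ‖defectOp (mulOp (Θs j)) (mulProd Θs i j.castSucc u)‖ ^ 2 else 0) ≤ ‖w‖ ^ 2 := by
      rw [PiLp.norm_sq_eq_of_L2]
      refine Finset.sum_le_sum fun j _ => ?_
      split_ifs with hj
      · rw [hx j hj]
        exact le_rfl
      · positivity
    rw [NNReal.coe_one, one_mul, Prod.norm_def]
    refine max_le ?_ ?_ <;> refine (sq_le_sq₀ (norm_nonneg _) (norm_nonneg _)).1 ?_
    · change ‖u‖ ^ 2 ≤ _
      linarith
    · change ‖w‖ ^ 2 ≤ _
      nlinarith [sq_nonneg ‖mulProd Θs i (Fin.last k) u‖]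
  have heq : chainSpan h i = S.map L.toLinearMap := by
    ext x
    constructor
    · rintro ⟨u, hu, w, hw, rfl⟩
      exact ⟨(u, w), (hmem _).2 ⟨hu, hw⟩, rfl⟩
    · rintro ⟨⟨u, w⟩, hx, rfl⟩
      obtain ⟨hu, hw⟩ := (hmem _).1 hx
      exact ⟨u, hu, w, hw, rfl⟩
  rw [heq]
  exact isClosed_map_of_bound L hS 1 hL

end

section

variable (hΘ : IsContractiveAnalytic Θ) (hΘs : ∀ j, IsContractiveAnalytic (Θs j))
  (hfac : ∀ z ∈ Metric.ball (0 : ℂ) 1, Θ z = chainProd (fun j => Θs j z) 0 (Fin.last k))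

include hΘ hΘs hfac in
-- At the bottom every component is prescribed, which forces `w = Z Δ_Θ u`; the factorization
-- identifies the first component with `Θ u`.
theorem chainSpan_zero (h : IsRegularAnalytic Θ Θs) : chainSpan h 0 = modelGraph Θ := by
  ext x
  rw [mem_modelGraph_iff]
  constructor
  · rintro ⟨u, hu, w, hw, rfl⟩
    refine ⟨u, hu, ?_⟩
    have h1 : w = h.Z (defectVec (mulOp Θ) u) := by
      ext1 j
      rw [h.Z_defectVec, hw j (Fin.zero_le _)]
    rw [h1, LinearIsometryEquiv.symm_apply_apply, ← mulOp_eq_mulProd hΘ hΘs hfac]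
    rfl
  · rintro ⟨u, hu, rfl⟩
    refine ⟨u, hu, h.Z (defectVec (mulOp Θ) u), fun j _ => h.Z_defectVec u j, ?_⟩
    rw [LinearIsometryEquiv.symm_apply_apply, ← mulOp_eq_mulProd hΘ hΘs hfac]
    rfl

include hΘ hΘs in
/-- The unitary of a regular factorization intertwines the multiplications by `e^{it}`. -/
theorem IsRegularAnalytic.expMul_Z_symm (h : IsRegularAnalytic Θ Θs)
    {w w' : PiLp 2 (fun j : Fin k => defectSpace (mulOp (Θs j)))}
    (hw : ∀ j, (w' j : L2 (E j.castSucc)) = expMul _ 1 (w j : L2 (E j.castSucc))) :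
    (h.Z.symm w' : L2 (E 0)) = expMul _ 1 (h.Z.symm w : L2 (E 0)) := by
  let s : defectSpace (mulOp Θ) →L[ℂ] defectSpace (mulOp Θ) :=
    (expMul (E 0) 1 ∘L (defectSpace (mulOp Θ)).subtypeL).codRestrict _
      fun v => hΘ.expMul_mem_defectSpace 1 v.2
  have hs : ∀ d j, (h.Z (s d) j : L2 (E j.castSucc)) =
      expMul _ 1 (h.Z d j : L2 (E j.castSucc)) := by
    intro d j
    have hc1 : Continuous fun d => h.Z d j :=
      (PiLp.continuous_apply 2 _ j).comp h.Z.continuous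
    -- By continuity it suffices to check the dense vectors `Δ_Θ f`, on which `Z` is explicit.
    refine (denseRange_defectVec (mulOp Θ)).induction_on
      (p := fun d => (h.Z (s d) j : L2 (E j.castSucc)) =
        expMul _ 1 (h.Z d j : L2 (E j.castSucc))) d
      (isClosed_eq (continuous_subtype_val.comp (hc1.comp s.continuous))
        ((expMul _ 1).continuous.comp (continuous_subtype_val.comp hc1))) fun f => ?_
    have h1 : s (defectVec (mulOp Θ) f) = defectVec (mulOp Θ) (expMul _ 1 f) :=
      Subtype.ext (hΘ.defectOp_expMul 1 f).symm
    rw [h1, h.Z_defectVec, h.Z_defectVec, coe_defectVec, coe_defectVec,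
      mulProd_expMul hΘs (Fin.zero_le _), (hΘs j).defectOp_expMul]
  have h2 : w' = h.Z (s (h.Z.symm w)) := by
    ext1 j
    refine Subtype.ext ?_
    rw [hs, LinearIsometryEquiv.apply_symm_apply, hw]
  rw [h2, LinearIsometryEquiv.symm_apply_apply]
  rfl

include hΘ hΘs in
theorem forwardShift_mem_chainSpan (h : IsRegularAnalytic Θ Θs) (i : Fin (k + 1))
    {x : WithLp 2 (L2 (E (Fin.last k)) × L2 (E 0))} (hx : x ∈ chainSpan h i) :
    forwardShift _ _ x ∈ chainSpan h i := by
  obtain ⟨u, hu, w, hw, rfl⟩ := hx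
  let w' : PiLp 2 (fun j : Fin k => defectSpace (mulOp (Θs j))) := WithLp.toLp 2 fun j =>
    ⟨expMul _ 1 (w j : L2 (E j.castSucc)), (hΘs j).expMul_mem_defectSpace 1 (w j).2⟩
  refine ⟨expMul _ 1 u, expMul_mem_H2 hu, w', fun j hj => ?_, ?_⟩
  · refine Subtype.ext ?_
    change expMul _ 1 (w j : L2 (E j.castSucc)) = _
    rw [hw j hj, coe_defectVec, coe_defectVec, mulProd_expMul hΘs hj, (hΘs j).defectOp_expMul]
  · rw [h.expMul_Z_symm hΘ hΘs (w := w) (w' := w') fun j => rfl, mulProd_expMul hΘs (Fin.le_last _),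
      forwardShift_apply]
    rfl

end

end ChainSpan

/-! ### Embedding the models of the factors -/

section Embedding

variable {k : ℕ} {E : Fin (k + 1) → Type u} [∀ i, NormedAddCommGroup (E i)]
  [∀ i, InnerProductSpace ℂ (E i)] [∀ i, CompleteSpace (E i)]
  {Θ : ℂ → E 0 →L[ℂ] E (Fin.last k)} {Θs : ∀ j : Fin k, ℂ → E j.castSucc →L[ℂ] E j.succ}

/-- The vector with components `Δ_j Θ_{j-1} ⋯ Θ_{i+1} u` for `j > i`, `v` for `j = i` and `0` for
`j < i`. -/
def blockVec (Θs : ∀ j : Fin k, ℂ → E j.castSucc →L[ℂ] E j.succ) (i : Fin k)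
    (x : modelAmbient (Θs i)) : PiLp 2 (fun j : Fin k => defectSpace (mulOp (Θs j))) :=
  WithLp.toLp 2 (Function.update
    (fun j => if i < j then defectVec (mulOp (Θs j)) (mulProd Θs i.succ j.castSucc x.1.fst) else 0)
    i ⟨x.1.snd, x.2.2⟩)

theorem blockVec_self (i : Fin k) (x : modelAmbient (Θs i)) :
    blockVec Θs i x i = ⟨x.1.snd, x.2.2⟩ := by
  simp only [blockVec, Function.update_self]

theorem blockVec_of_lt {i j : Fin k} (h : i < j) (x : modelAmbient (Θs i)) :
    blockVec Θs i x j = defectVec (mulOp (Θs j)) (mulProd Θs i.succ j.castSucc x.1.fst) := by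
  simp only [blockVec, Function.update_of_ne h.ne', if_pos h]

theorem blockVec_of_gt {i j : Fin k} (h : j < i) (x : modelAmbient (Θs i)) :
    blockVec Θs i x j = 0 := by
  simp only [blockVec, Function.update_of_ne h.ne, if_neg h.asymm]

/-- `u ⊕ v ↦ Θ_{k-1} ⋯ Θ_{i+1} u ⊕ Z_k^* (Δ_{k-1} Θ_{k-2} ⋯ Θ_{i+1} u ⊕ ⋯ ⊕ Δ_{i+1} u ⊕ v ⊕ 0)`,
as a linear map. -/
def blockLinear (h : IsRegularAnalytic Θ Θs) (i : Fin k) :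
    modelAmbient (Θs i) →ₗ[ℂ] WithLp 2 (L2 (E (Fin.last k)) × L2 (E 0)) where
  toFun x := WithLp.toLp 2 (mulProd Θs i.succ (Fin.last k) x.1.fst,
    (h.Z.symm (blockVec Θs i x) : L2 (E 0)))
  map_add' x y := by
    have h1 : blockVec Θs i (x + y) = blockVec Θs i x + blockVec Θs i y := by
      ext1 j
      rw [PiLp.add_apply]
      rcases lt_trichotomy j i with hj | rfl | hj
      · simp only [blockVec_of_gt hj, add_zero]
      · simp only [blockVec_self]
        rfl
      · simp only [blockVec_of_lt hj]
        refine Subtype.ext ?_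
        change defectOp _ (mulProd Θs i.succ j.castSucc (x.1.fst + y.1.fst)) =
          defectOp _ (mulProd Θs i.succ j.castSucc x.1.fst) +
            defectOp _ (mulProd Θs i.succ j.castSucc y.1.fst)
        rw [map_add, map_add]
    rw [h1, map_add, ← WithLp.toLp_add]
    congr 2
    change mulProd Θs i.succ (Fin.last k) (x.1.fst + y.1.fst) = _
    rw [map_add]
  map_smul' c x := by
    have h1 : blockVec Θs i (c • x) = c • blockVec Θs i x := by
      ext1 j
      rw [PiLp.smul_apply]
      rcases lt_trichotomy j i with hj | rfl | hj
      · simp only [blockVec_of_gt hj, smul_zero]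
      · simp only [blockVec_self]
        rfl
      · simp only [blockVec_of_lt hj]
        refine Subtype.ext ?_
        change defectOp _ (mulProd Θs i.succ j.castSucc (c • x.1.fst)) =
          c • defectOp _ (mulProd Θs i.succ j.castSucc x.1.fst)
        rw [map_smul, map_smul]
    rw [h1, map_smul, RingHom.id_apply, ← WithLp.toLp_smul]
    congr 2
    change mulProd Θs i.succ (Fin.last k) (c • x.1.fst) = _
    rw [map_smul]

theorem blockLinear_apply (h : IsRegularAnalytic Θ Θs) (i : Fin k) (x : modelAmbient (Θs i)) :
    blockLinear h i x = WithLp.toLp 2 (mulProd Θs i.succ (Fin.last k) x.1.fst,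
      (h.Z.symm (blockVec Θs i x) : L2 (E 0))) := rfl

theorem blockLinear_mem_chainSpan (h : IsRegularAnalytic Θ Θs) (i : Fin k)
    (x : modelAmbient (Θs i)) : blockLinear h i x ∈ chainSpan h i.succ :=
  ⟨x.1.fst, x.2.1, blockVec Θs i x,
    fun _ hj => blockVec_of_lt (fin_succ_le_castSucc_iff.1 hj) x, rfl⟩

/-- A vector `0 ⊕ Z_k^* w` where only the components `w_j` with `j < i` are nonzero lies in the
`i`-th space of the chain. -/
theorem toLp_zero_mem_chainSpan (h : IsRegularAnalytic Θ Θs) (i : Fin (k + 1))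
    {w : PiLp 2 (fun j : Fin k => defectSpace (mulOp (Θs j)))}
    (hw : ∀ j : Fin k, i ≤ j.castSucc → w j = 0) :
    WithLp.toLp 2 ((0 : L2 (E (Fin.last k))), (h.Z.symm w : L2 (E 0))) ∈ chainSpan h i := by
  refine ⟨0, zero_mem _, w, fun j hj => ?_, ?_⟩
  · rw [hw j hj]
    refine Subtype.ext ?_
    rw [coe_defectVec, map_zero, map_zero]
    rfl
  · rw [map_zero]

/-- The decomposition of the `(i+1)`-st space of the chain. -/
theorem exists_blockLinear_add (h : IsRegularAnalytic Θ Θs) (i : Fin k)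
    {y : WithLp 2 (L2 (E (Fin.last k)) × L2 (E 0))} (hy : y ∈ chainSpan h i.succ) :
    ∃ (x : modelAmbient (Θs i)) (w : PiLp 2 (fun j : Fin k => defectSpace (mulOp (Θs j)))),
      (∀ j : Fin k, i.castSucc ≤ j.castSucc → w j = 0) ∧
      y = blockLinear h i x + WithLp.toLp 2 (0, (h.Z.symm w : L2 (E 0))) := by
  obtain ⟨u, hu, w, hw, rfl⟩ := hy
  let x : modelAmbient (Θs i) := ⟨WithLp.toLp 2 (u, (w i : L2 (E i.castSucc))), hu, (w i).2⟩
  refine ⟨x, w - blockVec Θs i x, fun j hj => ?_, ?_⟩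
  · rw [PiLp.sub_apply, sub_eq_zero]
    rcases (Fin.castSucc_le_castSucc_iff.1 hj).eq_or_lt with rfl | hj
    · rw [blockVec_self]
      rfl
    · rw [blockVec_of_lt hj, hw j (fin_succ_le_castSucc_iff.2 hj)]
      rfl
  · rw [blockLinear_apply, ← WithLp.toLp_add, map_sub]
    congr 1
    refine Prod.ext ?_ ?_
    · exact (add_zero _).symm
    · exact (add_sub_cancel _ _).symm

/-- `Z` is unitary and the two component vectors have disjoint supports, `j ≥ i` and `j < i`. -/
theorem inner_blockLinear_toLp_zero (h : IsRegularAnalytic Θ Θs) (i : Fin k)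
    (x : modelAmbient (Θs i)) {w : PiLp 2 (fun j : Fin k => defectSpace (mulOp (Θs j)))}
    (hw : ∀ j : Fin k, i.castSucc ≤ j.castSucc → w j = 0) :
    ⟪blockLinear h i x, WithLp.toLp 2 ((0 : L2 (E (Fin.last k))), (h.Z.symm w : L2 (E 0)))⟫_ℂ
      = 0 := by
  rw [blockLinear_apply, WithLp.prod_inner_apply]
  change ⟪mulProd Θs i.succ (Fin.last k) x.1.fst, 0⟫_ℂ +
    ⟪h.Z.symm (blockVec Θs i x), h.Z.symm w⟫_ℂ = 0
  rw [inner_zero_right, zero_add, LinearIsometryEquiv.inner_map_map, PiLp.inner_apply]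
  refine Finset.sum_eq_zero fun j _ => ?_
  rcases lt_or_ge j i with hj | hj
  · rw [blockVec_of_gt hj, inner_zero_left]
  · rw [hw j (Fin.castSucc_le_castSucc_iff.2 hj), inner_zero_right]

variable [∀ i, TopologicalSpace.SeparableSpace (E i)]

section

variable (hΘs : ∀ j, IsContractiveAnalytic (Θs j))

/-- The isometric embedding of the ambient space of the model of `Θ_i`. -/
def blockIsometry (h : IsRegularAnalytic Θ Θs) (i : Fin k) :
    modelAmbient (Θs i) →ₗᵢ[ℂ] WithLp 2 (L2 (E (Fin.last k)) × L2 (E 0)) where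
  toLinearMap := blockLinear h i
  norm_map' x := by
    refine (sq_eq_sq₀ (norm_nonneg _) (norm_nonneg _)).1 ?_
    rw [blockLinear_apply, WithLp.prod_norm_sq_eq_of_L2]
    change ‖mulProd Θs i.succ (Fin.last k) x.1.fst‖ ^ 2 + ‖h.Z.symm (blockVec Θs i x)‖ ^ 2 =
      ‖x.1‖ ^ 2
    rw [LinearIsometryEquiv.norm_map, PiLp.norm_sq_eq_of_L2, WithLp.prod_norm_sq_eq_of_L2 x.1,
      ← norm_sq_mulProd hΘs i.succ x.1.fst, add_assoc]
    congr 1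
    -- The term `j = i` is the norm of `v`; the terms `j > i` together with the first component make
    -- up the norm of `u`.
    rw [← Finset.add_sum_erase _ _ (Finset.mem_univ i), ← Finset.add_sum_erase Finset.univ
      (fun j : Fin k => if i.succ ≤ j.castSucc then _ else _) (Finset.mem_univ i),
      if_neg (fun h => lt_irrefl i (fin_succ_le_castSucc_iff.1 h)), zero_add, add_comm,
      blockVec_self]
    congr 1
    refine Finset.sum_congr rfl fun j hj => ?_
    rcases lt_or_gt_of_ne (Finset.ne_of_mem_erase hj) with hj | hj
    · rw [blockVec_of_gt hj, if_neg (fun h => hj.asymm (fin_succ_le_castSucc_iff.1 h)), norm_zero]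
      norm_num
    · rw [blockVec_of_lt hj, if_pos (fin_succ_le_castSucc_iff.2 hj)]
      rfl

theorem blockIsometry_apply (h : IsRegularAnalytic Θ Θs) (i : Fin k) (x : modelAmbient (Θs i)) :
    blockIsometry hΘs h i x = blockLinear h i x := rfl

/-- The embedding maps the graph of `Θ_i` into the `i`-th space of the chain. -/
theorem blockIsometry_graph (h : IsRegularAnalytic Θ Θs) (i : Fin k) (x : modelAmbient (Θs i))
    {w : L2 (E i.castSucc)} (hw : w ∈ H2 (E i.castSucc))
    (hx : WithLp.toLp 2 (mulOp (Θs i) w, defectOp (mulOp (Θs i)) w) = x.1) :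
    blockIsometry hΘs h i x ∈ chainSpan h i.castSucc := by
  have h1 : x.1.fst = mulOp (Θs i) w := by rw [← hx]; rfl
  have h2 : x.1.snd = defectOp (mulOp (Θs i)) w := by rw [← hx]; rfl
  refine ⟨w, hw, blockVec Θs i x, fun j hj => ?_, ?_⟩
  · rcases (Fin.castSucc_le_castSucc_iff.1 hj).eq_or_lt with rfl | hj
    · rw [blockVec_self]
      refine Subtype.ext ?_
      rw [coe_defectVec, mulProd_self]
      exact h2
    · rw [blockVec_of_lt hj, h1, mulProd_castSucc_eq i (fin_succ_le_castSucc_iff.2 hj)]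
  · rw [blockIsometry_apply, blockLinear_apply, mulProd_castSucc_eq i (Fin.le_last _), h1]

/-- The decomposition of the `i`-th space of the chain. -/
theorem exists_blockIsometry_graph_add (h : IsRegularAnalytic Θ Θs) (i : Fin k)
    {y : WithLp 2 (L2 (E (Fin.last k)) × L2 (E 0))} (hy : y ∈ chainSpan h i.castSucc) :
    ∃ (x : modelAmbient (Θs i)) (w : PiLp 2 (fun j : Fin k => defectSpace (mulOp (Θs j)))),
      x.1 ∈ modelGraph (Θs i) ∧ (∀ j : Fin k, i.castSucc ≤ j.castSucc → w j = 0) ∧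
      y = blockIsometry hΘs h i x + WithLp.toLp 2 (0, (h.Z.symm w : L2 (E 0))) := by
  obtain ⟨u, hu, w, hw, rfl⟩ := hy
  have hg : WithLp.toLp 2 (mulOp (Θs i) u, defectOp (mulOp (Θs i)) u) ∈ modelGraph (Θs i) :=
    ⟨u, hu, rfl⟩
  let x : modelAmbient (Θs i) := ⟨_, (hΘs i).modelGraph_le_modelAmbient hg⟩
  have h1 : x.1.fst = mulOp (Θs i) u := rfl
  refine ⟨x, w - blockVec Θs i x, hg, fun j hj => ?_, ?_⟩
  · rw [PiLp.sub_apply, sub_eq_zero, hw j hj]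
    rcases (Fin.castSucc_le_castSucc_iff.1 hj).eq_or_lt with rfl | hj
    · rw [blockVec_self]
      refine Subtype.ext ?_
      rw [coe_defectVec, mulProd_self]
      rfl
    · rw [blockVec_of_lt hj, h1, mulProd_castSucc_eq i (fin_succ_le_castSucc_iff.2 hj)]
  · rw [blockIsometry_apply, blockLinear_apply, ← WithLp.toLp_add, map_sub, h1,
      mulProd_castSucc_eq i (Fin.le_last _)]
    congr 1
    refine Prod.ext ?_ ?_
    · exact (add_zero _).symm
    · exact (add_sub_cancel _ _).symm

/-- The embedding maps the model space of `Θ_i` into the orthogonal complement of the `i`-th space of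
the chain. -/
theorem blockIsometry_mem_orthogonal (h : IsRegularAnalytic Θ Θs) (i : Fin k)
    (x : modelAmbient (Θs i)) (hx : x.1 ∈ modelSpace (Θs i)) :
    blockIsometry hΘs h i x ∈ (chainSpan h i.castSucc)ᗮ := by
  rw [Submodule.mem_orthogonal']
  intro n hn
  obtain ⟨g, w, hg, hw, rfl⟩ := exists_blockIsometry_graph_add hΘs h i hn
  rw [inner_add_right, LinearIsometry.inner_map_map, Submodule.coe_inner,
    Submodule.inner_left_of_mem_orthogonal hg hx.2, zero_add]
  exact inner_blockLinear_toLp_zero h i x hw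

/-- The summand supported below `i` lies in the smaller space, hence vanishes by orthogonality.
Orthogonality to the embedded graph then pulls back through the isometry. -/
theorem exists_blockIsometry_eq (h : IsRegularAnalytic Θ Θs) (i : Fin k)
    {y : WithLp 2 (L2 (E (Fin.last k)) × L2 (E 0))} (hy : y ∈ chainSpan h i.succ)
    (hy' : y ∈ (chainSpan h i.castSucc)ᗮ) :
    ∃ x : modelAmbient (Θs i), x.1 ∈ modelSpace (Θs i) ∧ blockIsometry hΘs h i x = y := by
  obtain ⟨x, w, hw, rfl⟩ := exists_blockLinear_add h i hy
  have h1 := Submodule.inner_left_of_mem_orthogonal (toLp_zero_mem_chainSpan h i.castSucc hw) hy'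
  rw [inner_add_left, inner_blockLinear_toLp_zero h i x hw, zero_add, inner_self_eq_zero] at h1
  rw [h1, add_zero] at hy' ⊢
  refine ⟨x, ⟨x.2, ?_⟩, rfl⟩
  refine (Submodule.mem_orthogonal' _ _).2 fun g hg => ?_
  obtain ⟨u, hu, hug⟩ := (mem_modelGraph_iff _ _).1 hg
  have h2 := Submodule.inner_left_of_mem_orthogonal (blockIsometry_graph hΘs h i
    ⟨g, (hΘs i).modelGraph_le_modelAmbient hg⟩ hu hug) hy'
  rw [← blockIsometry_apply hΘs, LinearIsometry.inner_map_map] at h2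
  exact h2

/-- The embedding intertwines the forward shifts. -/
theorem forwardShift_blockIsometry (hΘ : IsContractiveAnalytic Θ) (h : IsRegularAnalytic Θ Θs)
    (i : Fin k) (x : modelAmbient (Θs i)) :
    forwardShift _ _ (blockIsometry hΘs h i x) =
      blockIsometry hΘs h i ⟨forwardShift _ _ x.1, (hΘs i).forwardShift_mem_modelAmbient x.2⟩ := by
  set x' : modelAmbient (Θs i) :=
    ⟨forwardShift _ _ x.1, (hΘs i).forwardShift_mem_modelAmbient x.2⟩
  have h1 : x'.1.fst = expMul _ 1 x.1.fst := rfl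
  have h2 : x'.1.snd = expMul _ 1 x.1.snd := rfl
  have h3 : (h.Z.symm (blockVec Θs i x') : L2 (E 0)) =
      expMul _ 1 (h.Z.symm (blockVec Θs i x) : L2 (E 0)) := by
    refine h.expMul_Z_symm hΘ hΘs fun j => ?_
    rcases lt_trichotomy j i with hj | rfl | hj
    · rw [blockVec_of_gt hj, blockVec_of_gt hj, ZeroMemClass.coe_zero, map_zero]
    · rw [blockVec_self, blockVec_self]
      exact h2
    · rw [blockVec_of_lt hj, blockVec_of_lt hj, coe_defectVec, coe_defectVec, h1,
        mulProd_expMul hΘs (fin_succ_le_castSucc_iff.2 hj), (hΘs j).defectOp_expMul]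
  rw [blockIsometry_apply, blockIsometry_apply, blockLinear_apply, blockLinear_apply, h3, h1,
    mulProd_expMul hΘs (Fin.le_last _), forwardShift_apply]
  rfl

end

end Embedding

/-! ### Invariant subspaces and their orthogonal differences -/

section Flag

variable {k : ℕ} {E : Fin (k + 1) → Type u} [∀ i, NormedAddCommGroup (E i)]
  [∀ i, InnerProductSpace ℂ (E i)] [∀ i, CompleteSpace (E i)]
  [∀ i, TopologicalSpace.SeparableSpace (E i)]
  {Θ : ℂ → E 0 →L[ℂ] E (Fin.last k)} {Θs : ∀ j : Fin k, ℂ → E j.castSucc →L[ℂ] E j.succ}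
  (hΘ : IsContractiveAnalytic Θ) (hΘs : ∀ j, IsContractiveAnalytic (Θs j))
  (hfac : ∀ z ∈ Metric.ball (0 : ℂ) 1, Θ z = chainProd (fun j => Θs j z) 0 (Fin.last k))

include hΘs in
theorem isClosed_invSubspace (h : IsRegularAnalytic Θ Θs) (i : Fin (k + 1)) :
    IsClosed (invSubspace h i : Set (modelSpace Θ)) :=
  (isClosed_chainSpan hΘs h i).preimage continuous_subtype_val

include hΘs in
theorem invSubspace_mono (h : IsRegularAnalytic Θ Θs) : Monotone (invSubspace h) :=
  fun _ _ hij => Submodule.comap_mono (chainSpan_mono hΘs h hij)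

include hΘ hΘs hfac

theorem modelGraph_le_chainSpan (h : IsRegularAnalytic Θ Θs) (i : Fin (k + 1)) :
    modelGraph Θ ≤ chainSpan h i := by
  rw [← chainSpan_zero hΘ hΘs hfac h]
  exact chainSpan_mono hΘs h (Fin.zero_le i)

/-- `T_Θ x` differs from `e^{it} x` by a graph vector, and `chainSpan h i` contains the graph and is
invariant under the shift. -/
theorem modelOp_mem_invSubspace (h : IsRegularAnalytic Θ Θs) (i : Fin (k + 1)) {x : modelSpace Θ}
    (hx : x ∈ invSubspace h i) : modelOp Θ x ∈ invSubspace h i := by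
  have h1 := modelGraph_le_chainSpan hΘ hΘs hfac h i (hΘ.forwardShift_sub_modelOp_mem x)
  have h2 := sub_mem (forwardShift_mem_chainSpan hΘ hΘs h i hx) h1
  rw [Submodule.subtype_apply, sub_sub_cancel] at h2
  exact h2

/-- The two ends are no exceptions: at `0` the graph meets the model space trivially, and at `k` the
chain reaches the ambient space. -/
theorem flag_eq_invSubspace (h : IsRegularAnalytic Θ Θs) (i : Fin (k + 1)) :
    flag h i = invSubspace h i := by
  unfold flag
  split_ifs with h0 h1
  · subst h0
    symm
    rw [eq_bot_iff]
    intro x hx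
    have hx' : (x : WithLp 2 (L2 (E (Fin.last k)) × L2 (E 0))) ∈ modelGraph Θ := by
      rw [← chainSpan_zero hΘ hΘs hfac h]
      exact hx
    refine Subtype.ext ?_
    exact inner_self_eq_zero.1 (Submodule.inner_right_of_mem_orthogonal hx' x.2.2)
  · subst h1
    symm
    rw [eq_top_iff]
    intro x _
    change (x : WithLp 2 (L2 (E (Fin.last k)) × L2 (E 0))) ∈ chainSpan h (Fin.last k)
    rw [chainSpan_last]
    exact modelSpace_le_modelAmbient x.2
  · rfl

theorem flag_mono (h : IsRegularAnalytic Θ Θs) : Monotone (flag h) := by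
  intro i j hij
  rw [flag_eq_invSubspace hΘ hΘs hfac, flag_eq_invSubspace hΘ hΘs hfac]
  exact invSubspace_mono hΘs h hij

theorem isClosed_flag (h : IsRegularAnalytic Θ Θs) (i : Fin (k + 1)) :
    IsClosed (flag h i : Set (modelSpace Θ)) := by
  rw [flag_eq_invSubspace hΘ hΘs hfac]
  exact isClosed_invSubspace hΘs h i

theorem hasOrthogonalProjection_diffSpace (h : IsRegularAnalytic Θ Θs) (i : Fin k) :
    (diffSpace h i).HasOrthogonalProjection := by
  have hc : IsClosed (diffSpace h i : Set (modelSpace Θ)) :=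
    (isClosed_flag hΘ hΘs hfac h i.succ).inter (Submodule.isClosed_orthogonal _)
  have : CompleteSpace (diffSpace h i) := hc.completeSpace_coe
  infer_instance

/-- A vector of `H(Θ)` is already orthogonal to the graph, so orthogonality to `M_i` and to the
larger `chainSpan` amount to the same. Differences can thus be computed in the ambient space. -/
theorem mem_diffSpace_iff (h : IsRegularAnalytic Θ Θs) (i : Fin k) (x : modelSpace Θ) :
    x ∈ diffSpace h i ↔
      (x : WithLp 2 (L2 (E (Fin.last k)) × L2 (E 0))) ∈ chainSpan h i.succ ∧
      (x : WithLp 2 (L2 (E (Fin.last k)) × L2 (E 0))) ∈ (chainSpan h i.castSucc)ᗮ := by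
  unfold diffSpace
  rw [Submodule.mem_inf, flag_eq_invSubspace hΘ hΘs hfac, flag_eq_invSubspace hΘ hΘs hfac]
  refine and_congr Iff.rfl ⟨fun hx => ?_, fun hx => ?_⟩
  · have : CompleteSpace (modelGraph Θ) := hΘ.isClosed_modelGraph.completeSpace_coe
    rw [Submodule.mem_orthogonal]
    intro n hn
    obtain ⟨g, hg, m, hm, rfl⟩ := (modelGraph Θ).exists_add_mem_mem_orthogonal n
    have hmN : m ∈ chainSpan h i.castSucc := by
      have := sub_mem hn (modelGraph_le_chainSpan hΘ hΘs hfac h i.castSucc hg)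
      rwa [add_sub_cancel_left] at this
    have hmA : m ∈ modelAmbient Θ := by
      rw [← chainSpan_last h]
      exact chainSpan_mono hΘs h (Fin.le_last _) hmN
    rw [inner_add_left, Submodule.inner_right_of_mem_orthogonal hg x.2.2, zero_add]
    exact (Submodule.mem_orthogonal _ _).1 hx ⟨m, hmA, hm⟩ hmN
  · rw [Submodule.mem_orthogonal]
    intro m hm
    exact (Submodule.mem_orthogonal _ _).1 hx m hm

theorem diffSpace_le_flag (h : IsRegularAnalytic Θ Θs) {i : Fin k} {m : Fin (k + 1)}
    (him : i.succ ≤ m) : diffSpace h i ≤ flag h m :=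
  inf_le_left.trans (flag_mono hΘ hΘs hfac h him)

theorem orthogonalFamily_diffSpace (h : IsRegularAnalytic Θ Θs) :
    OrthogonalFamily ℂ (fun i => diffSpace h i) (fun i => (diffSpace h i).subtypeₗᵢ) := by
  have key : ∀ {i j : Fin k}, i < j → ∀ (x : diffSpace h i) (y : diffSpace h j),
      ⟪(x : modelSpace Θ), (y : modelSpace Θ)⟫_ℂ = 0 := fun {i j} hij x y =>
    Submodule.inner_right_of_mem_orthogonal
      (diffSpace_le_flag hΘ hΘs hfac h (fin_succ_le_castSucc_iff.2 hij) x.2) y.2.2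
  intro i j hij x y
  rcases lt_or_gt_of_ne hij with hij | hij
  · exact key hij x y
  · exact inner_eq_zero_symm.1 (key hij y x)

theorem iSup_diffSpace (h : IsRegularAnalytic Θ Θs) : ⨆ i, diffSpace h i = ⊤ := by
  have key : ∀ m : Fin (k + 1), flag h m ≤ ⨆ i, diffSpace h i := by
    intro m
    induction m using Fin.induction with
    | zero => simp [flag]
    | succ m ih =>
      have : CompleteSpace (flag h m.castSucc) :=
        (isClosed_flag hΘ hΘs hfac h m.castSucc).completeSpace_coe
      rw [← Submodule.sup_orthogonal_inf_of_hasOrthogonalProjection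
        (flag_mono hΘ hΘs hfac h (Fin.castSucc_lt_succ (i := m)).le), inf_comm]
      exact sup_le ih (le_iSup (diffSpace h) m)
  have h1 := key (Fin.last k)
  rw [flag_eq_invSubspace hΘ hΘs hfac] at h1
  rw [eq_top_iff]
  refine le_trans ?_ h1
  intro x _
  change (x : WithLp 2 (L2 (E (Fin.last k)) × L2 (E 0))) ∈ chainSpan h (Fin.last k)
  rw [chainSpan_last]
  exact modelSpace_le_modelAmbient x.2

theorem block_modelOp_eq_zero (h : IsRegularAnalytic Θ Θs) {i j : Fin k} (hij : j < i)
    [(diffSpace h i).HasOrthogonalProjection] :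
    block (modelOp Θ) (diffSpace h i) (diffSpace h j) = 0 := by
  ext1 x
  change (diffSpace h i).orthogonalProjectionOnto (modelOp Θ x) = 0
  rw [Submodule.orthogonalProjectionOnto_eq_zero_iff]
  have h1 : modelOp Θ x ∈ flag h i.castSucc := by
    have hx := diffSpace_le_flag hΘ hΘs hfac h (fin_succ_le_castSucc_iff.2 hij) x.2
    rw [flag_eq_invSubspace hΘ hΘs hfac] at hx ⊢
    exact modelOp_mem_invSubspace hΘ hΘs hfac h _ hx
  exact (Submodule.mem_orthogonal' _ _).2 fun y hy =>
    Submodule.inner_right_of_mem_orthogonal h1 hy.2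

/-- The model space of `Θ_i` is isometric to the `i`-th difference space. -/
theorem exists_linearIsometryEquiv_diffSpace (h : IsRegularAnalytic Θ Θs) (i : Fin k) :
    ∃ U : modelSpace (Θs i) ≃ₗᵢ[ℂ] diffSpace h i, ∀ x : modelSpace (Θs i),
      ((U x : modelSpace Θ) : WithLp 2 (L2 (E (Fin.last k)) × L2 (E 0))) =
        blockIsometry hΘs h i ⟨x, modelSpace_le_modelAmbient x.2⟩ := by
  let J : modelSpace (Θs i) →ₗ[ℂ] WithLp 2 (L2 (E (Fin.last k)) × L2 (E 0)) :=
    (blockIsometry hΘs h i).toLinearMap ∘ₗ Submodule.inclusion modelSpace_le_modelAmbient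
  have h1 : ∀ x, J x ∈ chainSpan h i.succ := fun x => blockLinear_mem_chainSpan h i _
  have h2 : ∀ x, J x ∈ (chainSpan h i.castSucc)ᗮ := fun x =>
    blockIsometry_mem_orthogonal hΘs h i _ x.2
  have h3 : ∀ y : WithLp 2 (L2 (E (Fin.last k)) × L2 (E 0)), y ∈ chainSpan h i.succ →
      y ∈ (chainSpan h i.castSucc)ᗮ → y ∈ modelSpace Θ := fun y hy hy' => by
    refine ⟨?_, Submodule.orthogonal_le (modelGraph_le_chainSpan hΘ hΘs hfac h _) hy'⟩
    have := chainSpan_mono hΘs h (Fin.le_last _) hy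
    rwa [chainSpan_last] at this
  let J' : modelSpace (Θs i) →ₗᵢ[ℂ] diffSpace h i :=
    { toLinearMap := (J.codRestrict (modelSpace Θ) fun x => h3 _ (h1 x) (h2 x)).codRestrict _
        fun x => (mem_diffSpace_iff hΘ hΘs hfac h i _).2 ⟨h1 x, h2 x⟩
      norm_map' := fun x => (blockIsometry hΘs h i).norm_map _ }
  have hJ' : Function.Surjective J' := by
    rintro ⟨y, hy⟩
    obtain ⟨hy1, hy2⟩ := (mem_diffSpace_iff hΘ hΘs hfac h i y).1 hy
    obtain ⟨x, hx, hxy⟩ := exists_blockIsometry_eq hΘs h i hy1 hy2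
    exact ⟨⟨x.1, hx⟩, Subtype.ext (Subtype.ext hxy)⟩
  exact ⟨LinearIsometryEquiv.ofSurjective J' hJ', fun x => rfl⟩

theorem unitarilyEquivalent_block (h : IsRegularAnalytic Θ Θs) (i : Fin k)
    [(diffSpace h i).HasOrthogonalProjection] :
    UnitarilyEquivalent (X := diffSpace h i) (Y := modelSpace (Θs i))
      (block (modelOp Θ) (diffSpace h i) (diffSpace h i)) (modelOp (Θs i)) := by
  obtain ⟨U, hU⟩ := exists_linearIsometryEquiv_diffSpace hΘ hΘs hfac h i
  refine ⟨U.symm, fun y => ?_⟩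
  obtain ⟨x, rfl⟩ := U.surjective y
  rw [LinearIsometryEquiv.symm_apply_apply, LinearIsometryEquiv.symm_apply_eq]
  change (diffSpace h i).orthogonalProjectionOnto (modelOp Θ (U x)) = _
  -- the graph part of the forward shift of `x` is mapped into the previous space of the chain
  obtain ⟨w, hw, hwg⟩ := (mem_modelGraph_iff _ _).1 ((hΘs i).forwardShift_sub_modelOp_mem x)
  let g : modelAmbient (Θs i) := ⟨forwardShift _ _ x.1 - (modelOp (Θs i) x).1,
    sub_mem ((hΘs i).forwardShift_mem_modelAmbient (modelSpace_le_modelAmbient x.2))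
      (modelSpace_le_modelAmbient (modelOp (Θs i) x).2)⟩
  have hg := blockIsometry_graph hΘs h i g hw hwg
  have hW : forwardShift _ _ ((U x : modelSpace Θ) :
      WithLp 2 (L2 (E (Fin.last k)) × L2 (E 0))) =
      (U (modelOp (Θs i) x) : modelSpace Θ) + blockIsometry hΘs h i g := by
    rw [hU, hU, forwardShift_blockIsometry hΘs hΘ, ← map_add]
    congr 1
    refine Subtype.ext ?_
    exact (add_sub_cancel _ _).symm
  -- Both vectors represent the shift of `U x` modulo the previous space: one up to a vector of the
  -- graph of `Θ`, the other up to the embedded graph vector `g`.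
  have hn : (modelOp Θ (U x) - (U (modelOp (Θs i) x) : modelSpace Θ)) ∈
      invSubspace h i.castSucc := by
    have h1 := modelGraph_le_chainSpan hΘ hΘs hfac h i.castSucc
      (hΘ.forwardShift_sub_modelOp_mem (U x))
    rw [hW] at h1
    have h2 := sub_mem hg h1
    change (modelOp Θ (U x)).1 - (U (modelOp (Θs i) x) : modelSpace Θ).1 ∈ chainSpan h i.castSucc
    convert h2 using 1
    abel
  have h4 : (diffSpace h i).orthogonalProjectionOnto
      (modelOp Θ (U x) - (U (modelOp (Θs i) x) : modelSpace Θ)) = 0 := by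
    rw [Submodule.orthogonalProjectionOnto_eq_zero_iff]
    rw [← flag_eq_invSubspace hΘ hΘs hfac] at hn
    exact (Submodule.mem_orthogonal' _ _).2 fun y hy =>
      Submodule.inner_right_of_mem_orthogonal hn hy.2
  rw [map_sub, sub_eq_zero] at h4
  rw [h4]
  exact Submodule.orthogonalProjectionOnto_mem_subspace_eq_self _

end Flag

end RegularFactorization

end

theorem theorem3p3 {k : ℕ} (hk : 2 ≤ k) (E : Fin (k + 1) → Type*)
    [∀ i, NormedAddCommGroup (E i)] [∀ i, InnerProductSpace ℂ (E i)]
    [∀ i, CompleteSpace (E i)] [∀ i, TopologicalSpace.SeparableSpace (E i)]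
    (Θ : ℂ → E 0 →L[ℂ] E (Fin.last k))
    (Θs : ∀ j : Fin k, ℂ → E j.castSucc →L[ℂ] E j.succ)
    (hΘ : IsPurelyContractive Θ)
    (hΘs : ∀ j, IsContractiveAnalytic (Θs j))
    (hfac : ∀ z ∈ Metric.ball (0 : ℂ) 1,
      Θ z = chainProd (fun j => Θs j z) 0 (Fin.last k))
    (hreg : IsRegularAnalytic Θ Θs) :
    -- the `M_i` (`0 < i < k`) form an increasing chain of invariant (closed) subspaces
    (∀ i : Fin (k + 1), 0 < i → i < Fin.last k →
      IsClosed (invSubspace hreg i : Set (modelSpace Θ)) ∧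
      ∀ x ∈ invSubspace hreg i, modelOp Θ x ∈ invSubspace hreg i) ∧
    (∀ i j : Fin (k + 1), 0 < i → i ≤ j → j < Fin.last k →
      invSubspace hreg i ≤ invSubspace hreg j) ∧
    -- `H(Θ)` is the orthogonal direct sum of the differences
    OrthogonalFamily ℂ (fun i => diffSpace hreg i) (fun i => (diffSpace hreg i).subtypeₗᵢ) ∧
    (⨆ i, diffSpace hreg i) = ⊤ ∧
    -- the differences are closed, so that they have orthogonal projections
    ∃ _ : ∀ i, (diffSpace hreg i).HasOrthogonalProjection,
      -- `T_Θ` is block upper triangular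
      (∀ i j : Fin k, j < i →
        block (modelOp Θ) (diffSpace hreg i) (diffSpace hreg j) = 0) ∧
      -- the diagonal blocks are unitarily equivalent to the model operators of the factors
      ∀ i : Fin k,
        UnitarilyEquivalent (X := diffSpace hreg i) (Y := modelSpace (Θs i))
          (block (modelOp Θ) (diffSpace hreg i) (diffSpace hreg i)) (modelOp (Θs i)) := by
  refine ⟨fun i _ _ => ⟨isClosed_invSubspace hΘs hreg i,
      fun x hx => modelOp_mem_invSubspace hΘ.1 hΘs hfac hreg i hx⟩,
    fun i j _ hij _ => invSubspace_mono hΘs hreg hij,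
    orthogonalFamily_diffSpace hΘ.1 hΘs hfac hreg, iSup_diffSpace hΘ.1 hΘs hfac hreg,
    hasOrthogonalProjection_diffSpace hΘ.1 hΘs hfac hreg, ?_⟩
  have := hasOrthogonalProjection_diffSpace hΘ.1 hΘs hfac hreg
  exact ⟨fun i j hij => block_modelOp_eq_zero hΘ.1 hΘs hfac hreg hij,
    fun i => unitarilyEquivalent_block hΘ.1 hΘs hfac hreg i⟩
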